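/- Let $\Gamma$ be a discrete subgroup of $\mathrm{Iso}(H^n)$, the full isometry group of real hyperbolic space $H^n$. Identify $H^n$ with the open unit ball of $\mathbb{R}^n$ (Poincaré model), with sphere at infinity $S^{n-1}$, to which isometries of $H^n$ extend continuously. Let $L_\Gamma = S^{n-1}\cap\overline{\Gamma x_0}$ be the limit set, where $x_0\in H^n$ is any base point and the closure is taken in $\mathbb{R}^n$. Let $CH(\Gamma)\subset H^n$ be the intersection of all nonempty closed (geodesically) convex $\Gamma$-invariant subsets of $H^n$, and let $C(\Gamma)=CH(\Gamma)/\Gamma\subset H^n/\Gamma$ be the convex core. For $p\in H^n/\Gamma$ let $\mathrm{inj}(p)\in[0,\infty]$ be the injectivity radius at $p$: the supremum of the $r>0$ such that the metric ball $B_r(p)$ in $H^n/\Gamma$ is isometric, in the Riemannian sense (that is, through a bijection that preserves distances locally), to an $r$-ball in $H^n$ (with $\mathrm{inj}(p)=0$ if there is no such $r$). Suppose that the injectivity radius is bounded above on the convex core: there is $R<\infty$ with $\mathrm{inj}(p)\le R$ for all $p\in C(\Gamma)$. Then $\Gamma$ acts conservatively on its limit set $L_\Gamma$ with respect to Lebesgue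 measure on $S^{n-1}$: there is no measurable set $A\subset L_\Gamma$ of positive Lebesgue measure whose translates $\gamma(A)$, $\gamma\in\Gamma$, are disjoint up to sets of measure zero, i.e. such that $\gamma_1(A)\cap\gamma_2(A)$ has measure zero for all $\gamma_1\ne\gamma_2$ in $\Gamma$. -/

import Mathlib

open Set Filter Topology MeasureTheory
open scoped NNReal ENNReal

noncomputable section

/-- Real hyperbolic space `Hⁿ` of constant curvature `-1`, in the Poincaré ball model: its points
are the points of the open unit ball of `ℝⁿ`. -/
@[ext]
structure HyperbolicSpace (n : ℕ) where
  coords : EuclideanSpace ℝ (Fin n)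
  norm_lt_one : ‖coords‖ < 1

namespace HyperbolicSpace

variable {n : ℕ}

/-- The sphere at infinity `Sⁿ⁻¹`. -/
abbrev SphereAtInfinity (n : ℕ) : Type :=
  Metric.sphere (0 : EuclideanSpace ℝ (Fin n)) 1

/-- `cosh` of the hyperbolic distance of two points of the Poincaré ball. -/
def coshDist (x y : HyperbolicSpace n) : ℝ :=
  1 + 2 * ‖x.coords - y.coords‖ ^ 2 / ((1 - ‖x.coords‖ ^ 2) * (1 - ‖y.coords‖ ^ 2))

theorem one_sub_normSq_pos (x : HyperbolicSpace n) : 0 < 1 - ‖x.coords‖ ^ 2 := by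
  have h := x.norm_lt_one
  nlinarith [norm_nonneg x.coords]

theorem one_le_coshDist (x y : HyperbolicSpace n) : 1 ≤ coshDist x y := by
  have hx := one_sub_normSq_pos x
  have hy := one_sub_normSq_pos y
  unfold coshDist
  have : 0 ≤ 2 * ‖x.coords - y.coords‖ ^ 2 / ((1 - ‖x.coords‖ ^ 2) * (1 - ‖y.coords‖ ^ 2)) := by
    positivity
  linarith

theorem coshDist_comm (x y : HyperbolicSpace n) : coshDist x y = coshDist y x := by
  unfold coshDist
  rw [norm_sub_rev, mul_comm (1 - ‖x.coords‖ ^ 2)]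

theorem coshDist_self (x : HyperbolicSpace n) : coshDist x x = 1 := by
  simp [coshDist]

theorem eq_of_coshDist_eq_one {x y : HyperbolicSpace n} (h : coshDist x y = 1) : x = y := by
  have hx := one_sub_normSq_pos x
  have hy := one_sub_normSq_pos y
  unfold coshDist at h
  have h1 : 2 * ‖x.coords - y.coords‖ ^ 2 / ((1 - ‖x.coords‖ ^ 2) * (1 - ‖y.coords‖ ^ 2)) = 0 := by
    linarith
  rw [div_eq_zero_iff] at h1
  rcases h1 with h1 | h1
  · have h2 : ‖x.coords - y.coords‖ = 0 := by
      have : ‖x.coords - y.coords‖ ^ 2 = 0 := by linarith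
      exact pow_eq_zero_iff (two_ne_zero) |>.mp this
    exact HyperbolicSpace.ext (sub_eq_zero.mp (norm_eq_zero.mp h2))
  · exact absurd h1 (mul_pos hx hy).ne'

/-- Time coordinate of a point on the hyperboloid. -/
def hypTime (x : HyperbolicSpace n) : ℝ := (1 + ‖x.coords‖ ^ 2) / (1 - ‖x.coords‖ ^ 2)

/-- Space coordinates of a point on the hyperboloid. -/
def hypSpace (x : HyperbolicSpace n) : EuclideanSpace ℝ (Fin n) :=
  (2 / (1 - ‖x.coords‖ ^ 2)) • x.coords

theorem hypTime_sq (x : HyperbolicSpace n) : hypTime x ^ 2 = 1 + ‖hypSpace x‖ ^ 2 := by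
  have hx := (one_sub_normSq_pos x).ne'
  rw [hypTime, hypSpace, norm_smul, mul_pow, Real.norm_eq_abs, sq_abs]
  field_simp
  ring

theorem coshDist_eq (x y : HyperbolicSpace n) :
    coshDist x y = hypTime x * hypTime y - inner ℝ (hypSpace x) (hypSpace y) := by
  have hx := (one_sub_normSq_pos x).ne'
  have hy := (one_sub_normSq_pos y).ne'
  rw [coshDist, hypTime, hypTime, hypSpace, hypSpace, inner_smul_left, inner_smul_right,
    @norm_sub_sq ℝ]
  simp only [conj_trivial, RCLike.re_to_real]
  field_simp
  ring

theorem lorentz_nonneg {E : Type*} [NormedAddCommGroup E] [InnerProductSpace ℝ E]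
    {u b : E} {s β : ℝ} (hβ : β ^ 2 = 1 + ‖b‖ ^ 2) (h : inner ℝ u b = s * β) :
    0 ≤ ‖u‖ ^ 2 - s ^ 2 := by
  have h1 : (s * β) ^ 2 ≤ (‖u‖ * ‖b‖) ^ 2 := by
    rw [← h]
    exact sq_le_sq.mpr (by
      rw [abs_of_nonneg (mul_nonneg (norm_nonneg u) (norm_nonneg b))]
      exact abs_real_inner_le_norm u b)
  have h2 : 0 < β ^ 2 := by rw [hβ]; positivity
  have h3 : s ^ 2 * β ^ 2 ≤ ‖u‖ ^ 2 * β ^ 2 := by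
    have : ‖b‖ ^ 2 = β ^ 2 - 1 := by linarith
    nlinarith [sq_nonneg ‖u‖]
  have := le_of_mul_le_mul_right h3 h2
  linarith

theorem lorentz_triangle {E : Type*} [NormedAddCommGroup E] [InnerProductSpace ℝ E]
    {a b c : E} {α β γ p q : ℝ} (hα : α ^ 2 = 1 + ‖a‖ ^ 2) (hβ : β ^ 2 = 1 + ‖b‖ ^ 2)
    (hγ : γ ^ 2 = 1 + ‖c‖ ^ 2) (hp : p = α * β - inner ℝ a b) (hq : q = β * γ - inner ℝ b c) :
    α * γ - inner ℝ a c ≤ p * q + √(p ^ 2 - 1) * √(q ^ 2 - 1) := by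
  set B : ℝ := p * q - (α * γ - inner ℝ a c) with hB
  have key : ∀ t : ℝ, 0 ≤ (q ^ 2 - 1) * (t * t) + (2 * B) * t + (p ^ 2 - 1) := by
    intro t
    have h0 := lorentz_nonneg (u := (a - p • b) + t • (c - q • b)) (b := b)
      (s := (α - p * β) + t * (γ - q * β)) hβ (by
        simp only [inner_add_left, inner_sub_left, inner_smul_left, conj_trivial,
          real_inner_self_eq_norm_sq]
        rw [real_inner_comm b c]
        have e1 : inner ℝ a b = α * β - p := by linarith
        have e2 : inner ℝ b c = β * γ - q := by linarith
        rw [e1, e2]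
        linear_combination (-(p + t * q)) * (-hβ))
    rw [← real_inner_self_eq_norm_sq] at h0
    simp only [inner_add_left, inner_sub_left, inner_smul_left, inner_add_right, inner_sub_right,
      inner_smul_right, conj_trivial, real_inner_self_eq_norm_sq] at h0
    rw [real_inner_comm b c, real_inner_comm a b, real_inner_comm a c] at h0
    have e1 : inner ℝ a b = α * β - p := by linarith
    have e2 : inner ℝ b c = β * γ - q := by linarith
    have e3 : inner ℝ a c = α * γ - p * q + B := by rw [hB]; ring
    have e4 : ‖a‖ ^ 2 = α ^ 2 - 1 := by linarith
    have e5 : ‖b‖ ^ 2 = β ^ 2 - 1 := by linarith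
    have e6 : ‖c‖ ^ 2 = γ ^ 2 - 1 := by linarith
    rw [e1, e2, e3, e4, e5, e6] at h0
    refine h0.trans (le_of_eq ?_)
    ring
  have hd := discrim_le_zero key
  rw [discrim] at hd
  have hp1 : 0 ≤ p ^ 2 - 1 := by simpa using key 0
  have h1 : |B| ≤ √((p ^ 2 - 1) * (q ^ 2 - 1)) := Real.abs_le_sqrt (by nlinarith)
  rw [Real.sqrt_mul hp1] at h1
  have h2 := neg_abs_le B
  linarith

theorem arcosh_coshDist_triangle (x y z : HyperbolicSpace n) :
    Real.arcosh (coshDist x z) ≤ Real.arcosh (coshDist x y) + Real.arcosh (coshDist y z) := by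
  have hxy := one_le_coshDist x y
  have hyz := one_le_coshDist y z
  have hxz := one_le_coshDist x z
  have h := lorentz_triangle (hypTime_sq x) (hypTime_sq y) (hypTime_sq z)
    (coshDist_eq x y) (coshDist_eq y z)
  rw [← coshDist_eq] at h
  have h2 : coshDist x z
      ≤ Real.cosh (Real.arcosh (coshDist x y) + Real.arcosh (coshDist y z)) := by
    rw [Real.cosh_add, Real.cosh_arcosh hxy, Real.cosh_arcosh hyz, Real.sinh_arcosh hxy,
      Real.sinh_arcosh hyz]
    exact h
  have h3 := (Real.arcosh_le_arcosh (by linarith) (Real.cosh_pos _)).mpr h2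
  rwa [Real.arcosh_cosh (add_nonneg (Real.arcosh_nonneg hxy) (Real.arcosh_nonneg hyz))] at h3

/-- The hyperbolic distance, i.e. the Riemannian distance of `4 |dx|² / (1 - |x|²)²`. -/
instance : MetricSpace (HyperbolicSpace n) where
  dist x y := Real.arcosh (coshDist x y)
  dist_self x := by simp [coshDist_self]
  dist_comm x y := by simp only [coshDist_comm]
  dist_triangle := arcosh_coshDist_triangle
  eq_of_dist_eq_zero {x y} h :=
    eq_of_coshDist_eq_one ((Real.arcosh_eq_zero_iff (one_le_coshDist x y)).mp h)

/-- The full isometry group `Iso(Hⁿ)` (orientation-reversing isometries included). -/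
abbrev Iso (n : ℕ) : Type := HyperbolicSpace n ≃ᵢ HyperbolicSpace n

/-- The tautological action of `Iso(Hⁿ)` on `Hⁿ`. -/
instance : MulAction (Iso n) (HyperbolicSpace n) where
  smul g x := g x
  one_smul _ := rfl
  mul_smul _ _ _ := rfl

/-- The compact-open topology on `Iso(Hⁿ)`, which is its topology as a Lie group. -/
abbrev isoTopology (n : ℕ) : TopologicalSpace (Iso n) :=
  TopologicalSpace.induced
    (fun g : Iso n ↦ (⟨g, g.continuous⟩ : C(HyperbolicSpace n, HyperbolicSpace n))) inferInstance

/-- `Γ` is a discrete subgroup of `Iso(Hⁿ)`. -/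
def IsDiscreteGroup (Γ : Subgroup (Iso n)) : Prop :=
  @DiscreteTopology Γ (TopologicalSpace.induced Subtype.val (isoTopology n))

/-! ### Limit set and action at infinity -/

/-- The limit set `Sⁿ⁻¹ ∩ closure (Γ x₀)`, the closure being taken in `ℝⁿ`. -/
def limitSet (Γ : Subgroup (Iso n)) (x₀ : HyperbolicSpace n) : Set (SphereAtInfinity n) :=
  {ξ | (ξ : EuclideanSpace ℝ (Fin n)) ∈ closure (coords '' MulAction.orbit Γ x₀)}

/-- The graph of the continuous extension of the isometry `g` to the sphere at infinity:
`g x → η` as the point `x` of the open ball tends to `ξ` in the Euclidean topology. -/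
def ExtendsTo (g : Iso n) (ξ η : SphereAtInfinity n) : Prop :=
  Tendsto (fun x : HyperbolicSpace n ↦ (g x).coords)
    (comap coords (𝓝 (ξ : EuclideanSpace ℝ (Fin n)))) (𝓝 (η : EuclideanSpace ℝ (Fin n)))

/-- The image `g(A)` of a set `A ⊆ Sⁿ⁻¹` under the extension of `g` to the sphere at infinity. -/
def translate (g : Iso n) (A : Set (SphereAtInfinity n)) : Set (SphereAtInfinity n) :=
  {η | ∃ ξ ∈ A, ExtendsTo g ξ η}

/-- Lebesgue (surface) measure on the sphere at infinity. -/
def sphereMeasure (n : ℕ) : Measure (SphereAtInfinity n) :=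
  (volume : Measure (EuclideanSpace ℝ (Fin n))).toSphere

/-- `Γ` acts conservatively on the subset `L` of the sphere at infinity: no set `A ⊆ L` of positive
measure has translates `γ(A)`, `γ ∈ Γ`, that are disjoint up to sets of measure zero. -/
def ActsConservativelyOn (Γ : Subgroup (Iso n)) (L : Set (SphereAtInfinity n)) : Prop :=
  ¬ ∃ A ⊆ L, MeasurableSet A ∧ 0 < sphereMeasure n A ∧
    ∀ γ₁ ∈ Γ, ∀ γ₂ ∈ Γ, γ₁ ≠ γ₂ → sphereMeasure n (translate γ₁ A ∩ translate γ₂ A) = 0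

/-! ### The quotient, its convex core, and the injectivity radius -/

/-- The quotient `Hⁿ/Γ`. -/
abbrev QuotientSpace (Γ : Subgroup (Iso n)) : Type := MulAction.orbitRel.Quotient Γ (HyperbolicSpace n)

/-- The projection `Hⁿ → Hⁿ/Γ`. -/
def proj (Γ : Subgroup (Iso n)) (x : HyperbolicSpace n) : QuotientSpace Γ := Quotient.mk'' x

/-- The distance on `Hⁿ/Γ`: the least distance between lifts. -/
def quotDist (Γ : Subgroup (Iso n)) (p q : QuotientSpace Γ) : ℝ :=
  sInf {d | ∃ x y : HyperbolicSpace n, proj Γ x = p ∧ proj Γ y = q ∧ d = dist x y}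

/-- The open metric ball `B_r(p)` in `Hⁿ/Γ`. -/
def quotBall (Γ : Subgroup (Iso n)) (p : QuotientSpace Γ) (r : ℝ) : Set (QuotientSpace Γ) :=
  {q | quotDist Γ p q < r}

/-- `f : Hⁿ → Hⁿ/Γ` is locally distance preserving on `U`. -/
def IsLocallyIsometricOn (Γ : Subgroup (Iso n)) (f : HyperbolicSpace n → QuotientSpace Γ)
    (U : Set (HyperbolicSpace n)) : Prop :=
  ∀ x ∈ U, ∃ ε > 0, ∀ y ∈ U ∩ Metric.ball x ε, ∀ z ∈ U ∩ Metric.ball x ε,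
    quotDist Γ (f y) (f z) = dist y z

/-- The injectivity radius of `Hⁿ/Γ` at `p`: the supremum of the `r > 0` such that the metric ball
`B_r(p)` is isometric to an `r`-ball of `Hⁿ`. Isometric is meant in the Riemannian sense, i.e.
through a bijection that preserves distances locally. -/
def injRadius (Γ : Subgroup (Iso n)) (p : QuotientSpace Γ) : ℝ≥0∞ :=
  sSup {ρ | ∃ r : ℝ, 0 < r ∧ ρ = ENNReal.ofReal r ∧
    ∃ (o : HyperbolicSpace n) (f : HyperbolicSpace n → QuotientSpace Γ),
      BijOn f (Metric.ball o r) (quotBall Γ p r) ∧ IsLocallyIsometricOn Γ f (Metric.ball o r)}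

/-- Geodesic convexity: `K` contains the geodesic segment between any two of its points. In `Hⁿ`
the segment from `x` to `y` is the set of `z` with `d(x,z) + d(z,y) = d(x,y)`. -/
def IsGeodesicallyConvex (K : Set (HyperbolicSpace n)) : Prop :=
  ∀ x ∈ K, ∀ y ∈ K, ∀ z, dist x z + dist z y = dist x y → z ∈ K

/-- The convex hull `CH(Γ)`: the smallest nonempty closed convex `Γ`-invariant subset of `Hⁿ`,
i.e. the intersection of all of them. -/
def convexHullOf (Γ : Subgroup (Iso n)) : Set (HyperbolicSpace n) :=
  ⋂₀ {K | K.Nonempty ∧ IsClosed K ∧ IsGeodesicallyConvex K ∧ ∀ γ ∈ Γ, ∀ x ∈ K, γ x ∈ K}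

/-- The convex core `C(Γ) = CH(Γ)/Γ`, as a subset of `Hⁿ/Γ`. -/
def convexCore (Γ : Subgroup (Iso n)) : Set (QuotientSpace Γ) := proj Γ '' convexHullOf Γ

end HyperbolicSpace

end

/-! Suppose `A` is a subset of the limit set with positive measure. Pick a density point `ξ` of `A`
and a second point `η` of `A`. The geodesic from `η` to `ξ` lies in every closed convex invariant
set, hence in the convex hull, and its points `z` approach `ξ` nontangentially
(`exists_mem_convexHullOf`). The bound on the injectivity radius gives some `γ ≠ 1` in `Γ` that
moves `z` by less than `2 (R + 1)` (`exists_short_translate`).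

Write `δ = 1 - ‖z‖ ^ 2`. The shadow of `z` on the sphere is a cap about `ξ` of size comparable to
`δ`. Because `γ z` stays close to `z`, the boundary map of `γ` contracts this cap by at most a
bounded factor, and it cannot throw two well separated points of the cap both far from `ξ`. So some
ball of radius `δ / 10` near `ξ` is mapped into a ball of radius comparable to `δ` about `ξ`
(`exists_good_ball`). At a small enough scale `A` almost fills both balls, so `γ A` and `A` overlap
in positive measure (`exists_scale_measure_inter_ne_zero`), against the disjointness of the
translates by `γ` and `1`.

The distortion estimates all come from one identity (`normSq_boundaryMap_sub`): the boundary map is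
conformal with factors given by Poisson kernels. Density is measured in `ℝⁿ`, on cones over subsets
of the sphere and with the boundary map extended radially. For `n ≤ 1` the sphere is finite and the
pigeonhole principle suffices. -/

noncomputable section

/-- A map that contracts distances at most by the factor `L` contracts volumes at most by `L ^ n`. -/
theorem volume_le_of_dist_le_mul {n : ℕ} {f : EuclideanSpace ℝ (Fin n) → EuclideanSpace ℝ (Fin n)}
    {T : Set (EuclideanSpace ℝ (Fin n))} {L : ℝ≥0}
    (h : ∀ x ∈ T, ∀ y ∈ T, dist x y ≤ L * dist (f x) (f y)) :
    volume T ≤ (L : ℝ≥0∞) ^ n * volume (f '' T) := by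
  have hinj : InjOn f T := fun x hx y hy hxy ↦ by
    have := h x hx y hy
    rw [hxy, dist_self, mul_zero] at this
    exact dist_le_zero.mp this
  have hinv : LeftInvOn (Function.invFunOn f T) f T := hinj.leftInvOn_invFunOn
  have hlip : LipschitzOnWith L (Function.invFunOn f T) (f '' T) := by
    refine LipschitzOnWith.of_dist_le_mul ?_
    rintro _ ⟨x, hx, rfl⟩ _ ⟨y, hy, rfl⟩
    rw [hinv hx, hinv hy]
    exact h x hx y hy
  -- Lebesgue measure is a constant multiple of Hausdorff measure, so the Lipschitz bound for the
  -- inverse applies without any measurability of `T` or of its image.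
  have h1 := hlip.hausdorffMeasure_image_le (d := Module.finrank ℝ (EuclideanSpace ℝ (Fin n)))
    (Nat.cast_nonneg _)
  rw [hinv.image_image] at h1
  obtain ⟨c, h2⟩ : ∃ c : ℝ≥0, (volume : Measure (EuclideanSpace ℝ (Fin n)))
      = c • Measure.hausdorffMeasure (Module.finrank ℝ (EuclideanSpace ℝ (Fin n))) :=
    ⟨_, Measure.isAddLeftInvariant_eq_smul _ _⟩
  rw [ENNReal.rpow_natCast, finrank_euclideanSpace_fin] at h1
  rw [finrank_euclideanSpace_fin] at h2
  rw [h2, Measure.smul_apply, Measure.smul_apply, ENNReal.smul_def, ENNReal.smul_def, smul_eq_mul,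
    smul_eq_mul, mul_left_comm]
  gcongr

namespace HyperbolicSpace

variable {n : ℕ}

/-! ### Isometries and the Euclidean metric of the ball -/

theorem dist_eq_arcosh (x y : HyperbolicSpace n) : dist x y = Real.arcosh (coshDist x y) := rfl

theorem cosh_dist (x y : HyperbolicSpace n) : Real.cosh (dist x y) = coshDist x y :=
  Real.cosh_arcosh (one_le_coshDist x y)

theorem coshDist_map (g : Iso n) (x y : HyperbolicSpace n) :
    coshDist (g x) (g y) = coshDist x y := by
  rw [← cosh_dist, ← cosh_dist, g.dist_eq]

/-- The function `coshDist z x * (1 - ‖x‖ ^ 2)` of `x`, extended to all of `ℝⁿ`. On the sphere at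
infinity it is twice the inverse of the Poisson kernel of the ball with pole at `z`. -/
def poissonDenom (z : HyperbolicSpace n) (u : EuclideanSpace ℝ (Fin n)) : ℝ :=
  (1 - ‖u‖ ^ 2) + 2 * ‖z.coords - u‖ ^ 2 / (1 - ‖z.coords‖ ^ 2)

theorem poissonDenom_coords (z x : HyperbolicSpace n) :
    poissonDenom z x.coords = coshDist z x * (1 - ‖x.coords‖ ^ 2) := by
  have hx := (one_sub_normSq_pos x).ne'
  have hz := (one_sub_normSq_pos z).ne'
  rw [poissonDenom, coshDist]
  field_simp

theorem continuous_poissonDenom (z : HyperbolicSpace n) : Continuous (poissonDenom z) := by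
  unfold poissonDenom
  fun_prop

theorem poissonDenom_sphere (z : HyperbolicSpace n) (u : SphereAtInfinity n) :
    poissonDenom z u = 2 * ‖z.coords - u‖ ^ 2 / (1 - ‖z.coords‖ ^ 2) := by
  simp [poissonDenom]

theorem normSq_sub_eq (x y : HyperbolicSpace n) :
    ‖x.coords - y.coords‖ ^ 2
      = (coshDist x y - 1) / 2 * ((1 - ‖x.coords‖ ^ 2) * (1 - ‖y.coords‖ ^ 2)) := by
  have hx := (one_sub_normSq_pos x).ne'
  have hy := (one_sub_normSq_pos y).ne'
  rw [coshDist]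
  field_simp
  ring

/-- By `normSq_sub_eq`, `‖x - y‖ ^ 2` is an isometry invariant times the factors `1 - ‖x‖ ^ 2` and
`1 - ‖y‖ ^ 2`. These vanish at infinity; trading them for `poissonDenom`, which differs by another
invariant, gives an identity that survives the passage to the sphere. -/
theorem normSq_map_sub (g : Iso n) (z x y : HyperbolicSpace n) :
    ‖(g x).coords - (g y).coords‖ ^ 2 * (poissonDenom z x.coords * poissonDenom z y.coords)
      = ‖x.coords - y.coords‖ ^ 2
        * (poissonDenom (g z) (g x).coords * poissonDenom (g z) (g y).coords) := by
  simp only [normSq_sub_eq, poissonDenom_coords, coshDist_map]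
  ring

/-- The center of the ball. -/
def origin : HyperbolicSpace n := ⟨0, by simp⟩

theorem poissonDenom_origin (u : EuclideanSpace ℝ (Fin n)) :
    poissonDenom origin u = 1 + ‖u‖ ^ 2 := by
  simp [poissonDenom, origin]
  ring

theorem poissonDenom_coords_pos (z x : HyperbolicSpace n) : 0 < poissonDenom z x.coords := by
  rw [poissonDenom_coords]
  exact mul_pos (zero_lt_one.trans_le (one_le_coshDist z x)) (one_sub_normSq_pos x)

theorem poissonDenom_coords_le (z x : HyperbolicSpace n) :
    poissonDenom z x.coords ≤ 1 + 8 / (1 - ‖z.coords‖ ^ 2) := by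
  have h1 : ‖z.coords - x.coords‖ ≤ 2 := by
    linarith [norm_sub_le z.coords x.coords, x.norm_lt_one, z.norm_lt_one]
  have hz := one_sub_normSq_pos z
  unfold poissonDenom
  have h2 : 2 * ‖z.coords - x.coords‖ ^ 2 ≤ 8 := by
    nlinarith [norm_nonneg (z.coords - x.coords)]
  have h3 := div_le_div_of_nonneg_right h2 hz.le
  have h4 := sq_nonneg ‖x.coords‖
  linarith

/-- Isometries of the ball are Lipschitz for the Euclidean distance. -/
theorem norm_map_sub_le (g : Iso n) (x y : HyperbolicSpace n) :
    ‖(g x).coords - (g y).coords‖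
      ≤ (1 + 8 / (1 - ‖(g origin).coords‖ ^ 2)) * ‖x.coords - y.coords‖ := by
  have h := normSq_map_sub g origin x y
  set C := 1 + 8 / (1 - ‖(g origin).coords‖ ^ 2)
  have hx := poissonDenom_coords_le (g origin) (g x)
  have hy := poissonDenom_coords_le (g origin) (g y)
  have hx0 := poissonDenom_coords_pos (g origin) (g x)
  have hy0 := poissonDenom_coords_pos (g origin) (g y)
  rw [poissonDenom_origin, poissonDenom_origin] at h
  have hC : 0 ≤ C := hx0.le.trans hx
  refine (sq_le_sq₀ (norm_nonneg _) (mul_nonneg hC (norm_nonneg _))).mp ?_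
  rw [mul_pow]
  calc _ ≤ ‖(g x).coords - (g y).coords‖ ^ 2 * ((1 + ‖x.coords‖ ^ 2) * (1 + ‖y.coords‖ ^ 2)) := by
        refine le_mul_of_one_le_right (by positivity) ?_
        nlinarith [sq_nonneg ‖x.coords‖, sq_nonneg ‖y.coords‖,
          mul_nonneg (sq_nonneg ‖x.coords‖) (sq_nonneg ‖y.coords‖)]
    _ ≤ ‖x.coords - y.coords‖ ^ 2 * (C * C) := by
        rw [h]
        gcongr
    _ = _ := by ring

/-! ### Extension of isometries to the sphere at infinity -/

/-- The neighbourhoods in `Hⁿ` of a point of the sphere at infinity. -/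
abbrev endFilter (ξ : SphereAtInfinity n) : Filter (HyperbolicSpace n) :=
  comap coords (𝓝 (ξ : EuclideanSpace ℝ (Fin n)))

theorem tendsto_coords (ξ : SphereAtInfinity n) :
    Tendsto coords (endFilter ξ) (𝓝 (ξ : EuclideanSpace ℝ (Fin n))) := tendsto_comap

instance (ξ : SphereAtInfinity n) : (endFilter ξ).NeBot := by
  rw [comap_neBot_iff_frequently]
  have h1 : range (coords (n := n)) = Metric.ball 0 1 := by
    ext u
    simp only [mem_range, mem_ball_zero_iff]
    exact ⟨fun ⟨x, hx⟩ ↦ hx ▸ x.norm_lt_one, fun h ↦ ⟨⟨u, h⟩, rfl⟩⟩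
  have h2 : (ξ : EuclideanSpace ℝ (Fin n)) ∈ closure (Metric.ball 0 1) := by
    rw [closure_ball _ one_ne_zero]
    exact Metric.sphere_subset_closedBall ξ.2
  rw [← h1] at h2
  exact mem_closure_iff_frequently.mp h2

/-- Comparing `poissonDenom` at `origin` and at `g origin` bounds `1 - ‖g x‖ ^ 2` by a constant
times `1 - ‖x‖ ^ 2`. This is what puts the limit of `g x` on the sphere. -/
theorem tendsto_normSq_map (g : Iso n) (ξ : SphereAtInfinity n) :
    Tendsto (fun x ↦ 1 - ‖(g x).coords‖ ^ 2) (endFilter ξ) (𝓝 0) := by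
  have h1 : Tendsto (fun x : HyperbolicSpace n ↦
      (1 + 8 / (1 - ‖(g origin).coords‖ ^ 2)) * (1 - ‖x.coords‖ ^ 2)) (endFilter ξ) (𝓝 0) := by
    have : Tendsto (fun x : HyperbolicSpace n ↦
      (1 + 8 / (1 - ‖(g origin).coords‖ ^ 2)) * (1 - ‖x.coords‖ ^ 2)) (endFilter ξ)
      (𝓝 ((1 + 8 / (1 - ‖(g origin).coords‖ ^ 2)) * (1 - ‖(ξ : EuclideanSpace ℝ (Fin n))‖ ^ 2))) :=
      ((((tendsto_coords ξ).norm).pow 2).const_sub 1).const_mul _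
    simpa using this
  refine squeeze_zero (fun x ↦ (one_sub_normSq_pos (g x)).le) (fun x ↦ ?_) h1
  have h2 := poissonDenom_coords_le (g origin) (g x)
  rw [poissonDenom_coords, coshDist_map] at h2
  have h3 : coshDist origin x * (1 - ‖x.coords‖ ^ 2) = 1 + ‖x.coords‖ ^ 2 := by
    rw [← poissonDenom_coords, poissonDenom_origin]
  have hx := one_sub_normSq_pos x
  have hg := one_sub_normSq_pos (g x)
  calc 1 - ‖(g x).coords‖ ^ 2 ≤ (1 - ‖(g x).coords‖ ^ 2) * (1 + ‖x.coords‖ ^ 2) :=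
        le_mul_of_one_le_right hg.le (by nlinarith [sq_nonneg ‖x.coords‖])
    _ = (coshDist origin x * (1 - ‖(g x).coords‖ ^ 2)) * (1 - ‖x.coords‖ ^ 2) := by
        rw [← h3]; ring
    _ ≤ _ := by gcongr

theorem exists_extendsTo (g : Iso n) (ξ : SphereAtInfinity n) : ∃ η, ExtendsTo g ξ η := by
  have h1 : Cauchy (map (fun x ↦ (g x).coords) (endFilter ξ)) := by
    rw [cauchy_map_iff]
    refine ⟨inferInstance, ?_⟩
    rw [tendsto_uniformity_iff_dist_tendsto_zero]
    set C := 1 + 8 / (1 - ‖(g origin).coords‖ ^ 2) with hC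
    have h2 : Tendsto (fun p : HyperbolicSpace n × HyperbolicSpace n ↦
        C * ‖p.1.coords - p.2.coords‖) (endFilter ξ ×ˢ endFilter ξ) (𝓝 0) := by
      have h3 := (((tendsto_coords ξ).comp (tendsto_fst (g := endFilter ξ))).sub
        ((tendsto_coords ξ).comp (tendsto_snd (f := endFilter ξ)))).norm
      simpa using h3.const_mul C
    refine squeeze_zero (fun _ ↦ dist_nonneg) (fun p ↦ ?_) h2
    rw [dist_eq_norm]
    exact norm_map_sub_le g p.1 p.2
  obtain ⟨η, hη⟩ := CompleteSpace.complete h1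
  have hη : Tendsto (fun x ↦ (g x).coords) (endFilter ξ) (𝓝 η) := hη
  have h3 : 1 - ‖η‖ ^ 2 = 0 :=
    tendsto_nhds_unique ((hη.norm.pow 2).const_sub 1) (tendsto_normSq_map g ξ)
  have h4 : ‖η‖ = 1 := by
    have : (‖η‖ - 1) * (‖η‖ + 1) = 0 := by linarith
    rcases mul_eq_zero.mp this with h | h
    · linarith
    · linarith [norm_nonneg η]
  exact ⟨⟨η, by simpa using h4⟩, hη⟩

/-- The extension of an isometry of `Hⁿ` to the sphere at infinity. -/
def boundaryMap (g : Iso n) (ξ : SphereAtInfinity n) : SphereAtInfinity n :=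
  (exists_extendsTo g ξ).choose

theorem extendsTo_boundaryMap (g : Iso n) (ξ : SphereAtInfinity n) :
    ExtendsTo g ξ (boundaryMap g ξ) :=
  (exists_extendsTo g ξ).choose_spec

theorem tendsto_boundaryMap (g : Iso n) (ξ : SphereAtInfinity n) :
    Tendsto (fun x ↦ (g x).coords) (endFilter ξ)
      (𝓝 (boundaryMap g ξ : EuclideanSpace ℝ (Fin n))) :=
  extendsTo_boundaryMap g ξ

theorem ExtendsTo.eq_boundaryMap {g : Iso n} {ξ η : SphereAtInfinity n} (h : ExtendsTo g ξ η) :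
    η = boundaryMap g ξ :=
  Subtype.ext (tendsto_nhds_unique (show Tendsto _ (endFilter ξ) _ from h) (tendsto_boundaryMap g ξ))

theorem translate_eq_image (g : Iso n) (A : Set (SphereAtInfinity n)) :
    translate g A = boundaryMap g '' A := by
  ext η
  constructor
  · rintro ⟨ξ, hξ, h⟩
    exact ⟨ξ, hξ, h.eq_boundaryMap.symm⟩
  · rintro ⟨ξ, hξ, rfl⟩
    exact ⟨ξ, hξ, extendsTo_boundaryMap g ξ⟩

theorem boundaryMap_one (ξ : SphereAtInfinity n) : boundaryMap (1 : Iso n) ξ = ξ :=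
  (ExtendsTo.eq_boundaryMap (g := 1) (ξ := ξ) (tendsto_coords ξ)).symm

/-- Conformality of the boundary map, with respect to the visual metrics at `z` and `g z`. -/
theorem normSq_boundaryMap_sub (g : Iso n) (z : HyperbolicSpace n) (u v : SphereAtInfinity n) :
    ‖(boundaryMap g u : EuclideanSpace ℝ (Fin n)) - boundaryMap g v‖ ^ 2
        * (poissonDenom z u * poissonDenom z v)
      = ‖(u : EuclideanSpace ℝ (Fin n)) - v‖ ^ 2
        * (poissonDenom (g z) (boundaryMap g u) * poissonDenom (g z) (boundaryMap g v)) := by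
  have hu : Tendsto (fun p : HyperbolicSpace n × HyperbolicSpace n ↦ p.1.coords)
    (endFilter u ×ˢ endFilter v) _ := (tendsto_coords u).comp tendsto_fst
  have hv : Tendsto (fun p : HyperbolicSpace n × HyperbolicSpace n ↦ p.2.coords)
    (endFilter u ×ˢ endFilter v) _ := (tendsto_coords v).comp tendsto_snd
  have hgu : Tendsto (fun p : HyperbolicSpace n × HyperbolicSpace n ↦ (g p.1).coords)
    (endFilter u ×ˢ endFilter v) _ := (tendsto_boundaryMap g u).comp tendsto_fst
  have hgv : Tendsto (fun p : HyperbolicSpace n × HyperbolicSpace n ↦ (g p.2).coords)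
    (endFilter u ×ˢ endFilter v) _ := (tendsto_boundaryMap g v).comp tendsto_snd
  have c (w : HyperbolicSpace n) (a) := (continuous_poissonDenom w).tendsto a
  have h1 := ((hgu.sub hgv).norm.pow 2).mul (((c z _).comp hu).mul ((c z _).comp hv))
  have h2 := ((hu.sub hv).norm.pow 2).mul (((c (g z) _).comp hgu).mul ((c (g z) _).comp hgv))
  refine tendsto_nhds_unique h1 (h2.congr fun p ↦ ?_)
  exact (normSq_map_sub g z p.1 p.2).symm

/-! ### Injectivity radius and displacement -/

theorem proj_eq_proj_iff {Γ : Subgroup (Iso n)} {x y : HyperbolicSpace n} :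
    proj Γ x = proj Γ y ↔ ∃ γ ∈ Γ, γ y = x := by
  rw [proj, proj, Quotient.eq'', MulAction.orbitRel_apply, MulAction.mem_orbit_iff]
  exact ⟨fun ⟨γ, h⟩ ↦ ⟨γ.1, γ.2, h⟩, fun ⟨γ, hγ, h⟩ ↦ ⟨⟨γ, hγ⟩, h⟩⟩

theorem proj_map {Γ : Subgroup (Iso n)} {γ : Iso n} (hγ : γ ∈ Γ) (x : HyperbolicSpace n) :
    proj Γ (γ x) = proj Γ x :=
  proj_eq_proj_iff.mpr ⟨γ, hγ, rfl⟩

theorem bddBelow_liftDist (Γ : Subgroup (Iso n)) (p q : QuotientSpace Γ) :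
    BddBelow {d | ∃ x y : HyperbolicSpace n, proj Γ x = p ∧ proj Γ y = q ∧ d = dist x y} :=
  ⟨0, by rintro d ⟨x, y, -, -, rfl⟩; exact dist_nonneg⟩

theorem quotDist_proj_le (Γ : Subgroup (Iso n)) (x y : HyperbolicSpace n) :
    quotDist Γ (proj Γ x) (proj Γ y) ≤ dist x y :=
  csInf_le (bddBelow_liftDist Γ _ _) ⟨x, y, rfl, rfl, rfl⟩

theorem le_quotDist_proj {Γ : Subgroup (Iso n)} {x y : HyperbolicSpace n} {c : ℝ}
    (h : ∀ γ ∈ Γ, c ≤ dist x (γ y)) : c ≤ quotDist Γ (proj Γ x) (proj Γ y) := by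
  refine le_csInf ⟨_, x, y, rfl, rfl, rfl⟩ ?_
  rintro d ⟨x', y', hx, hy, rfl⟩
  obtain ⟨α, hα, rfl⟩ := proj_eq_proj_iff.mp hx
  obtain ⟨β, hβ, rfl⟩ := proj_eq_proj_iff.mp hy
  refine (h (α⁻¹ * β) (Γ.mul_mem (Γ.inv_mem hα) hβ)).trans (le_of_eq ?_)
  rw [← α.dist_eq]
  congr 1
  exact (α.apply_symm_apply (β y))

theorem exists_dist_lt_of_quotDist_lt {Γ : Subgroup (Iso n)} {x y : HyperbolicSpace n} {c : ℝ}
    (h : quotDist Γ (proj Γ x) (proj Γ y) < c) : ∃ γ ∈ Γ, dist x (γ y) < c := by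
  by_contra! h1
  exact h.not_ge (le_quotDist_proj h1)

/-- If no nontrivial element of `Γ` moves `x` by less than `2r`, the injectivity radius at the
image of `x` is at least `r`. -/
theorem le_injRadius {Γ : Subgroup (Iso n)} {x : HyperbolicSpace n} {r : ℝ} (hr : 0 < r)
    (h : ∀ γ ∈ Γ, dist x (γ x) < 2 * r → γ = 1) :
    ENNReal.ofReal r ≤ injRadius Γ (proj Γ x) := by
  -- If `y` and `γ y` both lie in the ball, then `x` and `γ x` are each within `r` of `γ y`.
  have hinj : ∀ γ ∈ Γ, ∀ y ∈ Metric.ball x r, γ y ∈ Metric.ball x r → γ = 1 := by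
    intro γ hγ y hy hγy
    refine h γ hγ ?_
    have h1 := dist_triangle x (γ y) (γ x)
    rw [γ.dist_eq] at h1
    rw [Metric.mem_ball] at hy hγy
    rw [dist_comm x (γ y)] at h1
    linarith
  refine le_sSup ⟨r, hr, rfl, x, proj Γ, ⟨?_, ?_, ?_⟩, ?_⟩
  · intro y hy
    exact (quotDist_proj_le Γ x y).trans_lt (by rwa [dist_comm])
  · intro y hy z hz hyz
    obtain ⟨γ, hγ, rfl⟩ := proj_eq_proj_iff.mp hyz
    rw [hinj γ hγ z hz hy]
    rfl
  · intro q hq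
    obtain ⟨y, rfl⟩ : ∃ y, proj Γ y = q := Quotient.exists_rep q
    obtain ⟨γ, hγ, hd⟩ := exists_dist_lt_of_quotDist_lt hq
    exact ⟨γ y, by rwa [Metric.mem_ball, dist_comm], proj_map hγ y⟩
  · intro w hw
    have hw' := Metric.mem_ball.mp hw
    -- If `γ z` were closer to `y` than `z` is, then `γ w` would be within four of these radii of
    -- `w`, hence in the ball about `x`, which forces `γ = 1`.
    refine ⟨(r - dist w x) / 4, by linarith, ?_⟩
    rintro y ⟨-, hy⟩ z ⟨-, hz⟩
    rw [Metric.mem_ball] at hy hz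
    refine le_antisymm (quotDist_proj_le Γ y z) (le_quotDist_proj fun γ hγ ↦ ?_)
    by_contra! hlt
    have h1 := dist_triangle_right y z w
    have h2 : dist (γ w) x < r := by
      have e1 := dist_triangle (γ w) w x
      have e2 := dist_triangle4 (γ w) (γ z) y w
      rw [γ.dist_eq, dist_comm w z, dist_comm (γ z) y] at e2
      linarith
    rw [hinj γ hγ w hw h2] at hlt
    exact lt_irrefl _ hlt

/-- This is the contrapositive of `le_injRadius` at radius `R + 1`, which strictly exceeds the
bound. -/
theorem exists_short_translate {Γ : Subgroup (Iso n)} {x : HyperbolicSpace n} {R : ℝ≥0}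
    (h : injRadius Γ (proj Γ x) ≤ R) : ∃ γ ∈ Γ, γ ≠ 1 ∧ dist x (γ x) < 2 * (R + 1) := by
  by_contra! h1
  have h2 := (le_injRadius (Γ := Γ) (x := x) (r := R + 1) (by positivity) fun γ hγ hd ↦ by
    by_contra hne
    exact hd.not_ge (h1 γ hγ hne)).trans h
  rw [ENNReal.ofReal_le_coe] at h2
  linarith

/-! ### Geodesic lines between limit points -/

/-- `coshDist z` is continuous at `z` in Euclidean coordinates, so Euclidean approximation implies
hyperbolic approximation. Limits with endpoints on the sphere can thus be taken in `ℝⁿ`. -/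
theorem mem_of_coords_mem_closure {z : HyperbolicSpace n} {K : Set (HyperbolicSpace n)} (hK : IsClosed K)
    (hz : z.coords ∈ closure (coords '' K)) : z ∈ K := by
  rw [← hK.closure_eq, Metric.mem_closure_iff]
  intro ε hε
  have hc : ContinuousAt (fun u : EuclideanSpace ℝ (Fin n) ↦
      1 + 2 * ‖z.coords - u‖ ^ 2 / ((1 - ‖z.coords‖ ^ 2) * (1 - ‖u‖ ^ 2))) z.coords := by
    have hz := one_sub_normSq_pos z
    have : (1 - ‖z.coords‖ ^ 2) * (1 - ‖z.coords‖ ^ 2) ≠ 0 := (mul_pos hz hz).ne'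
    fun_prop (disch := assumption)
  have h1 : ∀ᶠ u in 𝓝 z.coords,
      1 + 2 * ‖z.coords - u‖ ^ 2 / ((1 - ‖z.coords‖ ^ 2) * (1 - ‖u‖ ^ 2)) < Real.cosh ε := by
    refine hc.eventually_lt_const ?_
    simpa using Real.one_lt_cosh.mpr hε.ne'
  obtain ⟨_, h2, x, hx, rfl⟩ := mem_closure_iff_nhds.mp hz _ h1
  refine ⟨x, hx, ?_⟩
  have h3 : Real.cosh (dist z x) < Real.cosh ε := by
    rw [cosh_dist]
    exact h2
  rwa [Real.cosh_lt_cosh, abs_of_nonneg dist_nonneg, abs_of_pos hε] at h3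

/-! ### Segments and lines through the hyperboloid and projective models -/

theorem hypTime_pos (x : HyperbolicSpace n) : 0 < hypTime x :=
  div_pos (by positivity) (one_sub_normSq_pos x)

/-- The radial projection of a timelike vector `(T, S)` to the ball. -/
def ofTimelike (T : ℝ) (S : EuclideanSpace ℝ (Fin n)) : EuclideanSpace ℝ (Fin n) :=
  (T + √(T ^ 2 - ‖S‖ ^ 2))⁻¹ • S

/-- Here `m` is the Lorentz norm of `(T, S)`: the vector `(T, S) / m` lies on the hyperboloid and
`ofTimelike` is its stereographic projection, as the next three lemmas confirm. -/
theorem one_sub_normSq_ofTimelike {T m : ℝ} {S : EuclideanSpace ℝ (Fin n)} (hT : 0 < T)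
    (hm : 0 < m) (h : T ^ 2 - ‖S‖ ^ 2 = m ^ 2) :
    1 - ‖ofTimelike T S‖ ^ 2 = 2 * m / (T + m) := by
  rw [ofTimelike, h, Real.sqrt_sq hm.le, norm_smul, mul_pow, Real.norm_eq_abs, sq_abs]
  have : ‖S‖ ^ 2 = T ^ 2 - m ^ 2 := by linarith
  rw [this]
  field_simp
  ring

theorem norm_ofTimelike_lt_one {T m : ℝ} {S : EuclideanSpace ℝ (Fin n)} (hT : 0 < T)
    (hm : 0 < m) (h : T ^ 2 - ‖S‖ ^ 2 = m ^ 2) : ‖ofTimelike T S‖ < 1 := by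
  have h1 := one_sub_normSq_ofTimelike hT hm h
  have h2 : 0 < 2 * m / (T + m) := by positivity
  nlinarith [norm_nonneg (ofTimelike T S)]

theorem hypTime_eq_of_timelike {T m : ℝ} {S : EuclideanSpace ℝ (Fin n)} (hT : 0 < T)
    (hm : 0 < m) (h : T ^ 2 - ‖S‖ ^ 2 = m ^ 2) {z : HyperbolicSpace n}
    (hz : z.coords = ofTimelike T S) : hypTime z = T / m := by
  have h1 := one_sub_normSq_ofTimelike hT hm h
  have h2 : ‖ofTimelike T S‖ ^ 2 = 1 - 2 * m / (T + m) := by linarith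
  rw [hypTime, hz, h1, h2]
  field_simp
  ring

theorem hypSpace_eq_of_timelike {T m : ℝ} {S : EuclideanSpace ℝ (Fin n)} (hT : 0 < T)
    (hm : 0 < m) (h : T ^ 2 - ‖S‖ ^ 2 = m ^ 2) {z : HyperbolicSpace n}
    (hz : z.coords = ofTimelike T S) : hypSpace z = m⁻¹ • S := by
  rw [hypSpace, hz, one_sub_normSq_ofTimelike hT hm h, ofTimelike, h, Real.sqrt_sq hm.le, smul_smul]
  congr 1
  field_simp

theorem arcosh_add_arcosh {A B p : ℝ} (hA : 1 ≤ A) (hB : 1 ≤ B)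
    (h : A * B + √(A ^ 2 - 1) * √(B ^ 2 - 1) = p) :
    Real.arcosh A + Real.arcosh B = Real.arcosh p := by
  rw [← Real.arcosh_cosh (add_nonneg (Real.arcosh_nonneg hA) (Real.arcosh_nonneg hB)),
    Real.cosh_add, Real.cosh_arcosh hA, Real.cosh_arcosh hB, Real.sinh_arcosh hA,
    Real.sinh_arcosh hB, h]

/-- Nonnegative combinations of two points of the hyperboloid project to points of the segment
between them. -/
theorem dist_add_dist_of_combination {x y z : HyperbolicSpace n} {a b : ℝ} (ha : 0 ≤ a)
    (hb : 0 ≤ b) (hT : hypTime z = a * hypTime x + b * hypTime y)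
    (hS : hypSpace z = a • hypSpace x + b • hypSpace y) : dist x z + dist z y = dist x y := by
  have hx := hypTime_sq x
  have hy := hypTime_sq y
  have hz := hypTime_sq z
  have exy := coshDist_eq x y
  have exz := coshDist_eq x z
  have ezy := coshDist_eq z y
  have hp := one_le_coshDist x y
  rw [hS, ← real_inner_self_eq_norm_sq] at hz
  rw [hT] at hz exz ezy
  rw [hS] at exz ezy
  simp only [inner_add_left, inner_smul_left, inner_add_right, inner_smul_right, conj_trivial,
    real_inner_self_eq_norm_sq] at hz exz ezy
  rw [real_inner_comm (hypSpace x) (hypSpace y)] at hz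
  set p := coshDist x y
  have ei : inner ℝ (hypSpace x) (hypSpace y) = hypTime x * hypTime y - p := by linarith
  have ex : ‖hypSpace x‖ ^ 2 = hypTime x ^ 2 - 1 := by linarith
  have ey : ‖hypSpace y‖ ^ 2 = hypTime y ^ 2 - 1 := by linarith
  rw [ei, ex, ey] at hz
  rw [ei, ex] at exz
  rw [ei, ey] at ezy
  -- The hyperboloid equation for `z`. It yields `sinh d(x,z) = b sinh d(x,y)` and `sinh d(z,y) = a
  -- sinh d(x,y)`, after which the addition formula for `cosh` applies.
  have h1 : a ^ 2 + b ^ 2 + 2 * a * b * p = 1 := by linarith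
  have h2 : coshDist x z = a + b * p := by rw [exz]; ring
  have h3 : coshDist z y = a * p + b := by rw [ezy]; ring
  have hA := one_le_coshDist x z
  have hB := one_le_coshDist z y
  simp only [dist_eq_arcosh]
  refine arcosh_add_arcosh hA hB ?_
  have h4 : coshDist x z ^ 2 - 1 = b ^ 2 * (p ^ 2 - 1) := by rw [h2]; linear_combination h1
  have h5 : coshDist z y ^ 2 - 1 = a ^ 2 * (p ^ 2 - 1) := by rw [h3]; linear_combination h1
  have h6 : 0 ≤ p ^ 2 - 1 := by nlinarith
  rw [h4, h5, Real.sqrt_mul (sq_nonneg _), Real.sqrt_mul (sq_nonneg _), Real.sqrt_sq ha,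
    Real.sqrt_sq hb]
  have h7 : √(p ^ 2 - 1) * √(p ^ 2 - 1) = p ^ 2 - 1 := Real.mul_self_sqrt h6
  rw [h2, h3]
  linear_combination (a * b) * h7 + p * h1

/-- The point of the projective (Klein) model corresponding to the point `u` of the closed ball. -/
def kleinCoords (u : EuclideanSpace ℝ (Fin n)) : EuclideanSpace ℝ (Fin n) :=
  (2 / (1 + ‖u‖ ^ 2)) • u

theorem continuous_kleinCoords : Continuous (kleinCoords (n := n)) := by
  unfold kleinCoords
  have : ∀ u : EuclideanSpace ℝ (Fin n), 1 + ‖u‖ ^ 2 ≠ 0 := fun u ↦ by positivity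
  fun_prop (disch := assumption)

theorem kleinCoords_sphere (ξ : SphereAtInfinity n) : kleinCoords (ξ : EuclideanSpace ℝ (Fin n)) = ξ := by
  simp only [kleinCoords, norm_eq_of_mem_sphere]
  norm_num

/-- The point of the segment between `x` and `y` (or of the line with ends `x` and `y`, on the
sphere at infinity) with weights `s` and `1` in the projective model. -/
def weightedPoint (s : ℝ) (x y : EuclideanSpace ℝ (Fin n)) : EuclideanSpace ℝ (Fin n) :=
  ofTimelike (s + 1) (s • kleinCoords x + kleinCoords y)

/-- The square root is nonnegative at every argument, so the denominator is at least `s + 1` and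
continuity holds on the whole space, boundary points included. -/
theorem continuous_weightedPoint {s : ℝ} (hs : 0 < s) :
    Continuous fun p : EuclideanSpace ℝ (Fin n) × EuclideanSpace ℝ (Fin n) ↦
      weightedPoint s p.1 p.2 := by
  unfold weightedPoint ofTimelike
  have hk := continuous_kleinCoords (n := n)
  have hS : Continuous fun p : EuclideanSpace ℝ (Fin n) × EuclideanSpace ℝ (Fin n) ↦
      s • kleinCoords p.1 + kleinCoords p.2 :=
    ((hk.comp continuous_fst).const_smul s).add (hk.comp continuous_snd)
  have hT : Continuous fun p : EuclideanSpace ℝ (Fin n) × EuclideanSpace ℝ (Fin n) ↦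
      s + 1 + √((s + 1) ^ 2 - ‖s • kleinCoords p.1 + kleinCoords p.2‖ ^ 2) :=
    continuous_const.add (continuous_const.sub (hS.norm.pow 2)).sqrt
  exact (hT.inv₀ fun p ↦ by positivity).smul hS

/-- Projective coordinates are space over time on the hyperboloid, so weights `s` and `1` there
become weights `s / hypTime x` and `1 / hypTime y` on the hyperboloid, up to normalization by the
Lorentz norm `m`. -/
theorem exists_weightedPoint_segment {s : ℝ} (hs : 0 < s) (x y : HyperbolicSpace n) :
    ∃ z : HyperbolicSpace n, z.coords = weightedPoint s x.coords y.coords ∧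
      dist x z + dist z y = dist x y := by
  have hTx := hypTime_pos x
  have hTy := hypTime_pos y
  have key (w : HyperbolicSpace n) : kleinCoords w.coords = (hypTime w)⁻¹ • hypSpace w := by
    rw [kleinCoords, hypTime, hypSpace, smul_smul]
    congr 1
    have := (one_sub_normSq_pos w).ne'
    field_simp
  set a := s * (hypTime x)⁻¹ with ha
  set b := (hypTime y)⁻¹ with hb
  have ha0 : 0 < a := by positivity
  have hb0 : 0 < b := by positivity
  have haT : a * hypTime x = s := by rw [ha]; field_simp
  have hbT : b * hypTime y = 1 := by rw [hb]; field_simp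
  set S := s • kleinCoords x.coords + kleinCoords y.coords with hS
  have hS' : S = a • hypSpace x + b • hypSpace y := by
    rw [hS, key, key, smul_smul]
  have hp := one_le_coshDist x y
  have hm2 : (s + 1) ^ 2 - ‖S‖ ^ 2 = a ^ 2 + b ^ 2 + 2 * a * b * coshDist x y := by
    have hx := hypTime_sq x
    have hy := hypTime_sq y
    rw [hS', ← real_inner_self_eq_norm_sq]
    simp only [inner_add_left, inner_smul_left, inner_add_right, inner_smul_right, conj_trivial,
      real_inner_self_eq_norm_sq]
    rw [real_inner_comm (hypSpace x) (hypSpace y), coshDist_eq x y, ← haT, ← hbT]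
    linear_combination a ^ 2 * hx + b ^ 2 * hy
  set m := √(a ^ 2 + b ^ 2 + 2 * a * b * coshDist x y) with hm
  have hpos : 0 < a ^ 2 + b ^ 2 + 2 * a * b * coshDist x y := by positivity
  have hm0 : 0 < m := Real.sqrt_pos.mpr hpos
  have hmm : (s + 1) ^ 2 - ‖S‖ ^ 2 = m ^ 2 := by rw [hm2, hm, Real.sq_sqrt hpos.le]
  have hs1 : 0 < s + 1 := by linarith
  refine ⟨⟨weightedPoint s x.coords y.coords, norm_ofTimelike_lt_one hs1 hm0 hmm⟩, rfl, ?_⟩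
  refine dist_add_dist_of_combination (a := a / m) (b := b / m) (by positivity) (by positivity) ?_ ?_
  · rw [hypTime_eq_of_timelike hs1 hm0 hmm rfl, div_mul_eq_mul_div, div_mul_eq_mul_div, haT, hbT,
      add_div]
  · rw [hypSpace_eq_of_timelike hs1 hm0 hmm rfl, hS', smul_add, smul_smul, smul_smul,
      inv_mul_eq_div, inv_mul_eq_div]

/-- A closed convex set contains the geodesic lines between its points at infinity. -/
theorem mem_of_coords_eq_weightedPoint {K : Set (HyperbolicSpace n)} (hK : IsClosed K)
    (hconv : IsGeodesicallyConvex K) {ξ η : SphereAtInfinity n}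
    (hξ : (ξ : EuclideanSpace ℝ (Fin n)) ∈ closure (coords '' K))
    (hη : (η : EuclideanSpace ℝ (Fin n)) ∈ closure (coords '' K))
    {s : ℝ} (hs : 0 < s) {z : HyperbolicSpace n}
    (hz : z.coords = weightedPoint s (ξ : EuclideanSpace ℝ (Fin n)) η) : z ∈ K := by
  refine mem_of_coords_mem_closure hK ?_
  rw [hz]
  refine map_mem_closure₂ (f := weightedPoint s) (continuous_weightedPoint hs) hξ hη ?_
  rintro _ ⟨x, hx, rfl⟩ _ ⟨y, hy, rfl⟩
  obtain ⟨w, hw, hd⟩ := exists_weightedPoint_segment hs x y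
  exact ⟨w, hconv x hx y hy w hd, hw⟩

/-- The orbit of any point accumulates at the limit set. -/
theorem mem_closure_of_mem_limitSet {Γ : Subgroup (Iso n)} {x₀ y : HyperbolicSpace n}
    {ξ : SphereAtInfinity n} (hξ : ξ ∈ limitSet Γ x₀) {K : Set (HyperbolicSpace n)} (hy : y ∈ K)
    (hK : ∀ γ ∈ Γ, ∀ x ∈ K, γ x ∈ K) : (ξ : EuclideanSpace ℝ (Fin n)) ∈ closure (coords '' K) := by
  have hξ' : (ξ : EuclideanSpace ℝ (Fin n)) ∈ closure (coords '' MulAction.orbit Γ x₀) := hξ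
  obtain ⟨u, hu, hlim⟩ := mem_closure_iff_seq_limit.mp hξ'
  choose x hx hxu using hu
  choose γ hγ using hx
  have hγ (k) : (γ k : Iso n) x₀ = x k := hγ k
  refine mem_closure_of_tendsto (f := fun k ↦ ((γ k : Iso n) y).coords) (b := atTop) ?_
    (Eventually.of_forall fun k ↦ ⟨_, hK _ (γ k).2 _ hy, rfl⟩)
  -- `γ x₀` and `γ y` stay at constant hyperbolic distance, so their Euclidean distance vanishes as
  -- `γ x₀` tends to the sphere.
  have h1 : Tendsto (fun k ↦ √((coshDist x₀ y - 1) / 2 * (1 - ‖u k‖ ^ 2))) atTop (𝓝 0) := by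
    have := (((hlim.norm.pow 2).const_sub 1).const_mul ((coshDist x₀ y - 1) / 2)).sqrt
    simpa using this
  have h2 : Tendsto (fun k ↦ ((γ k : Iso n) y).coords - u k) atTop (𝓝 0) := by
    refine squeeze_zero_norm (fun k ↦ ?_) h1
    refine Real.le_sqrt_of_sq_le ?_
    rw [← hxu k, ← hγ k, norm_sub_rev, normSq_sub_eq, coshDist_map]
    have e1 := one_le_coshDist x₀ y
    have e2 := one_sub_normSq_pos ((γ k : Iso n) x₀)
    refine mul_le_mul_of_nonneg_left ?_ (by linarith)
    refine mul_le_of_le_one_right e2.le ?_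
    linarith [sq_nonneg ‖((γ k : Iso n) y).coords‖]
  simpa using h2.add hlim

/-- Geodesic lines between limit points lie in the convex hull, and come arbitrarily close to
their ends in nontangential position. -/
theorem exists_mem_convexHullOf {Γ : Subgroup (Iso n)} {x₀ : HyperbolicSpace n}
    {ξ η : SphereAtInfinity n} (hξ : ξ ∈ limitSet Γ x₀) (hη : η ∈ limitSet Γ x₀) (hne : ξ ≠ η)
    {ε : ℝ} (hε : 0 < ε) : ∃ z ∈ convexHullOf Γ, 1 - ‖z.coords‖ ^ 2 < ε ∧
      ‖z.coords - ξ‖ ≤ 1 - ‖z.coords‖ ^ 2 := by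
  have nξ : ‖(ξ : EuclideanSpace ℝ (Fin n))‖ = 1 := norm_eq_of_mem_sphere ξ
  have nη : ‖(η : EuclideanSpace ℝ (Fin n))‖ = 1 := norm_eq_of_mem_sphere η
  set q : ℝ := 1 - inner ℝ (ξ : EuclideanSpace ℝ (Fin n)) η with hq
  have hd : ‖(ξ : EuclideanSpace ℝ (Fin n)) - η‖ ^ 2 = 2 * q := by
    rw [@norm_sub_sq ℝ, nξ, nη]
    simp only [RCLike.re_to_real]
    ring
  have hq0 : 0 < q := by
    have : 0 < ‖(ξ : EuclideanSpace ℝ (Fin n)) - η‖ :=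
      norm_pos_iff.mpr (sub_ne_zero.mpr (Subtype.coe_injective.ne hne))
    nlinarith
  have hq2 : q ≤ 2 := by
    have : ‖(ξ : EuclideanSpace ℝ (Fin n)) - η‖ ≤ 2 := by
      linarith [norm_sub_le (ξ : EuclideanSpace ℝ (Fin n)) η]
    nlinarith [norm_nonneg ((ξ : EuclideanSpace ℝ (Fin n)) - η)]
  -- The weight `s` is chosen below so that `m` is the Lorentz norm of `(s + 1, s ξ + η)`, whence `1
  -- - ‖z‖ ^ 2 = 2 m / (s + 1 + m)`. As `m ^ 2 ≤ 4 s`, the bound `8 / ε ≤ m` makes this less than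
  -- `ε`; `4 ≤ m` is ample for the nontangential estimate.
  set m : ℝ := max 4 (8 / ε) with hm
  have hm4 : 4 ≤ m := le_max_left _ _
  have hmε : 8 / ε ≤ m := le_max_right _ _
  set s : ℝ := m ^ 2 / (2 * q) with hs
  have hm0 : 0 < m := by linarith
  have hs0 : 0 < s := by positivity
  have hsq : 2 * s * q = m ^ 2 := by rw [hs]; field_simp
  have hT : 0 < s + 1 := by linarith
  have hmm : (s + 1) ^ 2 - ‖s • (ξ : EuclideanSpace ℝ (Fin n)) + η‖ ^ 2 = m ^ 2 := by
    rw [@norm_add_sq ℝ, norm_smul, nξ, nη, inner_smul_left, ← hsq, hq, Real.norm_of_nonneg hs0.le]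
    simp only [RCLike.re_to_real, conj_trivial]
    ring
  have hw : weightedPoint s (ξ : EuclideanSpace ℝ (Fin n)) η
      = ofTimelike (s + 1) (s • (ξ : EuclideanSpace ℝ (Fin n)) + (η : EuclideanSpace ℝ (Fin n))) := by
    rw [weightedPoint, kleinCoords_sphere, kleinCoords_sphere]
  have hδ := one_sub_normSq_ofTimelike hT hm0 hmm
  refine ⟨⟨weightedPoint s (ξ : EuclideanSpace ℝ (Fin n)) η,
    hw ▸ norm_ofTimelike_lt_one hT hm0 hmm⟩, ?_, ?_, ?_⟩
  · rintro K ⟨⟨y, hy⟩, hcl, hconv, hinv⟩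
    exact mem_of_coords_eq_weightedPoint hcl hconv (mem_closure_of_mem_limitSet hξ hy hinv)
      (mem_closure_of_mem_limitSet hη hy hinv) hs0 rfl
  · simp only [hw]
    rw [hδ, div_lt_iff₀ (by positivity)]
    rw [div_le_iff₀ hε] at hmε
    have h1 : m ^ 2 ≤ 4 * s := by nlinarith
    nlinarith
  · simp only [hw]
    rw [hδ, ofTimelike, hmm, Real.sqrt_sq hm0.le]
    have h1 : (s + 1 + m)⁻¹ • (s • (ξ : EuclideanSpace ℝ (Fin n)) + (η : EuclideanSpace ℝ (Fin n))) - ξ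
        = (s + 1 + m)⁻¹ • ((η : EuclideanSpace ℝ (Fin n)) - (1 + m) • (ξ : EuclideanSpace ℝ (Fin n))) := by
      have : (ξ : EuclideanSpace ℝ (Fin n)) = (s + 1 + m)⁻¹ • ((s + 1 + m) • (ξ : EuclideanSpace ℝ (Fin n))) := by
        rw [smul_smul, inv_mul_cancel₀ (by positivity), one_smul]
      nth_rw 2 [this]
      rw [← smul_sub]
      congr 1
      module
    rw [h1, norm_smul, Real.norm_of_nonneg (by positivity), inv_mul_eq_div]
    gcongr
    refine abs_le_of_sq_le_sq' ?_ (by positivity) |>.2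
    rw [@norm_sub_sq ℝ, norm_smul, nξ, nη, inner_smul_right, Real.norm_of_nonneg (by positivity),
      real_inner_comm]
    simp only [RCLike.re_to_real]
    have : inner ℝ (ξ : EuclideanSpace ℝ (Fin n)) (η : EuclideanSpace ℝ (Fin n)) = 1 - q := by
      linarith
    rw [this]
    nlinarith

/-! ### Distortion of the boundary map on shadows -/

theorem normSq_sub_le {z w : HyperbolicSpace n} {p : ℝ} (hp : coshDist z w ≤ p) :
    ‖z.coords - w.coords‖ ^ 2 ≤ p / 2 * ((1 - ‖z.coords‖ ^ 2) * (1 - ‖w.coords‖ ^ 2)) := by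
  rw [normSq_sub_eq]
  have := mul_pos (one_sub_normSq_pos z) (one_sub_normSq_pos w)
  gcongr
  linarith

/-- Points at bounded hyperbolic distance have comparable Euclidean distance to the sphere. -/
theorem one_sub_normSq_le {z w : HyperbolicSpace n} {p : ℝ} (hp : coshDist z w ≤ p) :
    1 - ‖z.coords‖ ^ 2 ≤ 6 * p * (1 - ‖w.coords‖ ^ 2) := by
  have hd := normSq_sub_le hp
  have hp1 := (one_le_coshDist z w).trans hp
  have hz := one_sub_normSq_pos z
  have hw := one_sub_normSq_pos w
  have hz1 := z.norm_lt_one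
  have hw1 := w.norm_lt_one
  have htri : ‖w.coords‖ ≤ ‖z.coords‖ + ‖z.coords - w.coords‖ := by
    have := norm_sub_le z.coords (z.coords - w.coords)
    rwa [sub_sub_cancel] at this
  have h1 : 1 - ‖z.coords‖ ^ 2 ≤ 2 * (1 - ‖z.coords‖) := by nlinarith [norm_nonneg z.coords]
  have h2 : 1 - ‖w.coords‖ ≤ 1 - ‖w.coords‖ ^ 2 := by nlinarith [norm_nonneg w.coords]
  set δ := 1 - ‖z.coords‖ ^ 2
  set δ' := 1 - ‖w.coords‖ ^ 2
  have hpδ : δ' ≤ p * δ' := le_mul_of_one_le_left hw.le hp1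
  -- AM-GM applied to `4 ‖z - w‖ ^ 2 ≤ 2 p δ δ'`; the term `δ / 4` is then absorbed on the left of
  -- the goal.
  have h3 : 2 * ‖z.coords - w.coords‖ ≤ 2 * (p * δ') + δ / 4 := by
    refine abs_le_of_sq_le_sq' ?_ (by positivity) |>.2
    nlinarith [sq_nonneg (2 * (p * δ') - δ / 4)]
  nlinarith

theorem norm_sub_le_of_coshDist_le {z w : HyperbolicSpace n} {p : ℝ} (hp : coshDist z w ≤ p) :
    ‖z.coords - w.coords‖ ≤ 2 * p * (1 - ‖z.coords‖ ^ 2) := by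
  have hd := normSq_sub_le hp
  have hp1 := (one_le_coshDist z w).trans hp
  have hz := one_sub_normSq_pos z
  have h1 : 1 - ‖w.coords‖ ^ 2 ≤ 6 * p * (1 - ‖z.coords‖ ^ 2) :=
    one_sub_normSq_le (by rwa [coshDist_comm])
  refine abs_le_of_sq_le_sq' ?_ (by positivity) |>.2
  calc _ ≤ p / 2 * ((1 - ‖z.coords‖ ^ 2) * (6 * p * (1 - ‖z.coords‖ ^ 2))) := by
        refine hd.trans ?_
        gcongr
    _ ≤ _ := by nlinarith [sq_nonneg (p * (1 - ‖z.coords‖ ^ 2))]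

/-- The distance from `z` to the sphere is `1 - ‖z‖`, at least half of `1 - ‖z‖ ^ 2`. This bound
holds on the whole sphere; the matching upper bound `poissonDenom_le` holds only on the shadow. -/
theorem le_poissonDenom (z : HyperbolicSpace n) (u : SphereAtInfinity n) :
    (1 - ‖z.coords‖ ^ 2) / 2 ≤ poissonDenom z u := by
  have hz := one_sub_normSq_pos z
  rw [poissonDenom_sphere, le_div_iff₀ hz]
  have h1 : 1 - ‖z.coords‖ ≤ ‖z.coords - u‖ := by
    have := norm_sub_norm_le (u : EuclideanSpace ℝ (Fin n)) z.coords
    rwa [norm_eq_of_mem_sphere, norm_sub_rev] at this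
  have h2 : (1 - ‖z.coords‖ ^ 2) / 2 ≤ 1 - ‖z.coords‖ := by
    nlinarith [norm_nonneg z.coords, z.norm_lt_one]
  have h3 : (1 - ‖z.coords‖ ^ 2) / 2 ≤ ‖z.coords - u‖ := h2.trans h1
  nlinarith

/-- The cap of radius `4 δ` about `ξ` plays the role of the shadow of `z`. On it `‖z - u‖ ≤ 5 δ`,
and `50 = 2 * 5 ^ 2`. -/
theorem poissonDenom_le {z : HyperbolicSpace n} {ξ u : SphereAtInfinity n}
    (hz : ‖z.coords - ξ‖ ≤ 1 - ‖z.coords‖ ^ 2)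
    (hu : ‖(u : EuclideanSpace ℝ (Fin n)) - ξ‖ ≤ 4 * (1 - ‖z.coords‖ ^ 2)) :
    poissonDenom z u ≤ 50 * (1 - ‖z.coords‖ ^ 2) := by
  have hz0 := one_sub_normSq_pos z
  rw [poissonDenom_sphere, div_le_iff₀ hz0]
  have h1 : ‖z.coords - u‖ ≤ 5 * (1 - ‖z.coords‖ ^ 2) := by
    have := norm_sub_le_norm_sub_add_norm_sub z.coords (ξ : EuclideanSpace ℝ (Fin n)) u
    rw [norm_sub_rev (ξ : EuclideanSpace ℝ (Fin n))] at this
    linarith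
  nlinarith [norm_nonneg (z.coords - u)]

/-- An isometry that moves `z` a bounded distance contracts the shadow of `z` by at most a bounded
factor. -/
theorem norm_sub_le_boundaryMap (g : Iso n) {z : HyperbolicSpace n} {p : ℝ}
    (hp : coshDist z (g z) ≤ p) {ξ u v : SphereAtInfinity n}
    (hz : ‖z.coords - ξ‖ ≤ 1 - ‖z.coords‖ ^ 2)
    (hu : ‖(u : EuclideanSpace ℝ (Fin n)) - ξ‖ ≤ 4 * (1 - ‖z.coords‖ ^ 2))
    (hv : ‖(v : EuclideanSpace ℝ (Fin n)) - ξ‖ ≤ 4 * (1 - ‖z.coords‖ ^ 2)) :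
    ‖(u : EuclideanSpace ℝ (Fin n)) - v‖
      ≤ 600 * p * ‖(boundaryMap g u : EuclideanSpace ℝ (Fin n)) - boundaryMap g v‖ := by
  have hp1 := (one_le_coshDist z (g z)).trans hp
  have h := normSq_boundaryMap_sub g z u v
  have hδ := one_sub_normSq_pos z
  have hPu := poissonDenom_le hz hu
  have hPv := poissonDenom_le hz hv
  have hPu0 := (half_pos hδ).le.trans (le_poissonDenom z u)
  have hPv0 := (half_pos hδ).le.trans (le_poissonDenom z v)
  have hlow (w : SphereAtInfinity n) :
      (1 - ‖z.coords‖ ^ 2) / (12 * p) ≤ poissonDenom (g z) w := by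
    refine le_trans ?_ (le_poissonDenom (g z) w)
    rw [div_le_iff₀ (by positivity)]
    linarith [one_sub_normSq_le hp]
  set δ := 1 - ‖z.coords‖ ^ 2
  set D := ‖(boundaryMap g u : EuclideanSpace ℝ (Fin n)) - boundaryMap g v‖
  set d := ‖(u : EuclideanSpace ℝ (Fin n)) - v‖
  -- Upper bound `50 δ` at `z` against lower bound `δ / (12 p)` at `g z`: their ratio is the factor
  -- `600 p`.
  have h1 : d ^ 2 * (δ / (12 * p) * (δ / (12 * p))) ≤ D ^ 2 * ((50 * δ) * (50 * δ)) := by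
    calc _ ≤ d ^ 2 * (poissonDenom (g z) (boundaryMap g u)
            * poissonDenom (g z) (boundaryMap g v)) := by
          gcongr
          · exact (by positivity : 0 ≤ δ / (12 * p)).trans (hlow _)
          · exact hlow _
          · exact hlow _
      _ = _ := h.symm
      _ ≤ _ := by gcongr
  refine abs_le_of_sq_le_sq' ?_ (by positivity) |>.2
  have h2 : d ^ 2 * (δ / (12 * p) * (δ / (12 * p))) = d ^ 2 * (δ / (12 * p)) ^ 2 := by ring
  have h3 : D ^ 2 * ((50 * δ) * (50 * δ)) = (600 * p * D) ^ 2 * (δ / (12 * p)) ^ 2 := by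
    field_simp
    ring
  rw [h2, h3] at h1
  exact le_of_mul_le_mul_right h1 (by positivity)

/-- An isometry that moves `z` a bounded distance cannot move two points of the shadow of `z` that
are far apart, as seen from `z`, both away from the shadow of `z`. -/
theorem boundaryMap_near_or_near (g : Iso n) {z : HyperbolicSpace n} {p : ℝ}
    (hp : coshDist z (g z) ≤ p) {ξ u v : SphereAtInfinity n}
    (hz : ‖z.coords - ξ‖ ≤ 1 - ‖z.coords‖ ^ 2)
    (hu : ‖(u : EuclideanSpace ℝ (Fin n)) - ξ‖ ≤ 4 * (1 - ‖z.coords‖ ^ 2))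
    (hv : ‖(v : EuclideanSpace ℝ (Fin n)) - ξ‖ ≤ 4 * (1 - ‖z.coords‖ ^ 2))
    (huv : (1 - ‖z.coords‖ ^ 2) / 4 ≤ ‖(u : EuclideanSpace ℝ (Fin n)) - v‖) :
    ‖(boundaryMap g u : EuclideanSpace ℝ (Fin n)) - ξ‖ ≤ 4800 * p * (1 - ‖z.coords‖ ^ 2) ∨
      ‖(boundaryMap g v : EuclideanSpace ℝ (Fin n)) - ξ‖ ≤ 4800 * p * (1 - ‖z.coords‖ ^ 2) := by
  by_contra! hfar
  obtain ⟨hA, hB⟩ := hfar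
  have hp1 := (one_le_coshDist z (g z)).trans hp
  have h := normSq_boundaryMap_sub g z u v
  have hδ := one_sub_normSq_pos z
  have hPu := poissonDenom_le hz hu
  have hPv := poissonDenom_le hz hv
  have hPu0 := (half_pos hδ).le.trans (le_poissonDenom z u)
  have hPv0 := (half_pos hδ).le.trans (le_poissonDenom z v)
  have hzz := norm_sub_le_of_coshDist_le hp
  have hδ' : 1 - ‖(g z).coords‖ ^ 2 ≤ 6 * p * (1 - ‖z.coords‖ ^ 2) :=
    one_sub_normSq_le (by rwa [coshDist_comm])
  have hδ'0 := one_sub_normSq_pos (g z)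
  set δ := 1 - ‖z.coords‖ ^ 2
  have hpδ : δ ≤ p * δ := le_mul_of_one_le_left hδ.le hp1
  -- For `w` far from `ξ` on the scale `p δ`, the point `g z` is at least half as far from `w` as
  -- `ξ` is, so `poissonDenom (g z) w` grows quadratically in `‖w - ξ‖`.
  have hlow (w : SphereAtInfinity n)
      (hw : 4800 * p * δ < ‖(w : EuclideanSpace ℝ (Fin n)) - ξ‖) :
      ‖(w : EuclideanSpace ℝ (Fin n)) - ξ‖ ^ 2 / (12 * p * δ) ≤ poissonDenom (g z) w := by
    have h1 : ‖(w : EuclideanSpace ℝ (Fin n)) - ξ‖ / 2 ≤ ‖(g z).coords - w‖ := by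
      have e1 := norm_sub_le_norm_sub_add_norm_sub (w : EuclideanSpace ℝ (Fin n)) (g z).coords ξ
      have e2 := norm_sub_le_norm_sub_add_norm_sub (g z).coords z.coords ξ
      rw [norm_sub_rev _ (g z).coords] at e1
      rw [norm_sub_rev _ z.coords] at e2
      linarith
    rw [poissonDenom_sphere, div_le_div_iff₀ (by positivity) hδ'0]
    calc _ ≤ ‖(w : EuclideanSpace ℝ (Fin n)) - ξ‖ ^ 2 * (6 * p * δ) := by gcongr
      _ = 2 * (‖(w : EuclideanSpace ℝ (Fin n)) - ξ‖ / 2) ^ 2 * (12 * p * δ) := by ring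
      _ ≤ _ := by gcongr
  have hlu := hlow _ hA
  have hlv := hlow _ hB
  have htri := norm_sub_le_norm_sub_add_norm_sub (boundaryMap g u : EuclideanSpace ℝ (Fin n)) ξ
    (boundaryMap g v : EuclideanSpace ℝ (Fin n))
  rw [norm_sub_rev (ξ : EuclideanSpace ℝ (Fin n))] at htri
  set A := ‖(boundaryMap g u : EuclideanSpace ℝ (Fin n)) - ξ‖
  set B := ‖(boundaryMap g v : EuclideanSpace ℝ (Fin n)) - ξ‖
  have hA0 : 0 < A := lt_of_le_of_lt (by positivity) hA
  have hB0 : 0 < B := lt_of_le_of_lt (by positivity) hB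
  have h1 : (δ / 4) ^ 2 * (A ^ 2 / (12 * p * δ) * (B ^ 2 / (12 * p * δ)))
      ≤ (A + B) ^ 2 * ((50 * δ) * (50 * δ)) := by
    calc _ ≤ ‖(u : EuclideanSpace ℝ (Fin n)) - v‖ ^ 2 * (poissonDenom (g z) (boundaryMap g u)
            * poissonDenom (g z) (boundaryMap g v)) := by
          gcongr
          exact (by positivity : 0 ≤ A ^ 2 / (12 * p * δ)).trans hlu
      _ = _ := h.symm
      _ ≤ _ := by gcongr
  have h2 : (δ / 4) ^ 2 * (A ^ 2 / (12 * p * δ) * (B ^ 2 / (12 * p * δ)))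
      = (A * B / (48 * p)) ^ 2 := by
    field_simp
    ring
  have h3 : (A + B) ^ 2 * ((50 * δ) * (50 * δ)) = ((A + B) * (50 * δ)) ^ 2 := by ring
  rw [h2, h3] at h1
  have h4 := abs_le_of_sq_le_sq' h1 (by positivity) |>.2
  rw [div_le_iff₀ (by positivity)] at h4
  -- `h4` says `A B ≤ 2400 p δ (A + B)`, while `A, B > 4800 p δ` give the strict reverse inequality.
  nlinarith [mul_lt_mul_of_pos_right hA hB0, mul_lt_mul_of_pos_right hB hA0]

/-! ### Cones over subsets of the sphere at infinity -/

/-- The open cone over a subset of the sphere. -/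
def cone (A : Set (SphereAtInfinity n)) : Set (EuclideanSpace ℝ (Fin n)) :=
  {x | ∃ r : ℝ, 0 < r ∧ ∃ u ∈ A, x = r • (u : EuclideanSpace ℝ (Fin n))}

theorem ne_zero_of_polar {r : ℝ} (hr : 0 < r) (u : SphereAtInfinity n) :
    r • (u : EuclideanSpace ℝ (Fin n)) ≠ 0 := by
  rw [← norm_ne_zero_iff, norm_smul, norm_eq_of_mem_sphere, Real.norm_of_nonneg hr.le]
  simpa using hr.ne'

theorem exists_polar {x : EuclideanSpace ℝ (Fin n)} (hx : x ≠ 0) :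
    ∃ r : ℝ, 0 < r ∧ ∃ u : SphereAtInfinity n, x = r • (u : EuclideanSpace ℝ (Fin n)) := by
  have h := norm_pos_iff.mpr hx
  refine ⟨‖x‖, h, ⟨‖x‖⁻¹ • x, ?_⟩, ?_⟩
  · rw [mem_sphere_zero_iff_norm, norm_smul, norm_inv, norm_norm, inv_mul_cancel₀ h.ne']
  · rw [smul_smul, mul_inv_cancel₀ h.ne', one_smul]

theorem polar_unique {r s : ℝ} (hr : 0 < r) (hs : 0 < s) {u v : SphereAtInfinity n}
    (h : r • (u : EuclideanSpace ℝ (Fin n)) = s • (v : EuclideanSpace ℝ (Fin n))) :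
    r = s ∧ u = v := by
  have h1 := congrArg norm h
  rw [norm_smul, norm_smul, norm_eq_of_mem_sphere, norm_eq_of_mem_sphere, mul_one, mul_one,
    Real.norm_of_nonneg hr.le, Real.norm_of_nonneg hs.le] at h1
  subst h1
  exact ⟨rfl, Subtype.ext (smul_right_injective _ hr.ne' h)⟩

theorem smul_mem_cone {A : Set (SphereAtInfinity n)} {r : ℝ} (hr : 0 < r)
    {u : SphereAtInfinity n} : r • (u : EuclideanSpace ℝ (Fin n)) ∈ cone A ↔ u ∈ A := by
  constructor
  · rintro ⟨s, hs, v, hv, h⟩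
    exact (polar_unique hr hs h).2 ▸ hv
  · exact fun h ↦ ⟨r, hr, u, h, rfl⟩

theorem measurableSet_cone {A : Set (SphereAtInfinity n)} (hA : MeasurableSet A) :
    MeasurableSet (cone A) := by
  have h : cone A = Subtype.val ''
      ((fun x ↦ (homeomorphUnitSphereProd (EuclideanSpace ℝ (Fin n)) x).1) ⁻¹' A) := by
    ext x
    constructor
    · rintro ⟨r, hr, u, hu, rfl⟩
      refine ⟨⟨_, ne_zero_of_polar hr u⟩, ?_, rfl⟩
      have : (⟨_, ne_zero_of_polar hr u⟩ : ({0}ᶜ : Set (EuclideanSpace ℝ (Fin n))))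
          = (homeomorphUnitSphereProd (EuclideanSpace ℝ (Fin n))).symm (u, ⟨r, hr⟩) :=
        Subtype.ext rfl
      rw [this]
      simpa using hu
    · rintro ⟨y, hy, rfl⟩
      refine ⟨_, (homeomorphUnitSphereProd (EuclideanSpace ℝ (Fin n)) y).2.2, _, hy, ?_⟩
      have := (homeomorphUnitSphereProd (EuclideanSpace ℝ (Fin n))).symm_apply_apply y
      exact (congrArg Subtype.val this).symm
  rw [h]
  refine (MeasurableEmbedding.subtype_coe (measurableSet_singleton _).compl).measurableSet_image.mpr ?_
  exact (measurable_fst.comp (homeomorphUnitSphereProd _).measurable) hA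

open scoped Pointwise

theorem smul_cone {A : Set (SphereAtInfinity n)} {ρ : ℝ} (hρ : 0 < ρ) : ρ • cone A = cone A := by
  ext x
  rw [mem_smul_set]
  constructor
  · rintro ⟨_, ⟨r, hr, u, hu, rfl⟩, rfl⟩
    exact ⟨ρ * r, by positivity, u, hu, smul_smul _ _ _⟩
  · rintro ⟨r, hr, u, hu, rfl⟩
    refine ⟨_, ⟨ρ⁻¹ * r, by positivity, u, hu, rfl⟩, ?_⟩
    rw [smul_smul, mul_inv_cancel_left₀ hρ.ne']

theorem Ioo_smul_subset_cone (A : Set (SphereAtInfinity n)) :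
    Ioo (0 : ℝ) 1 • ((↑) '' A : Set (EuclideanSpace ℝ (Fin n))) ⊆ cone A := by
  rintro _ ⟨r, hr, _, ⟨u, hu, rfl⟩, rfl⟩
  exact ⟨r, hr.1, u, hu, rfl⟩

theorem cone_subset_iUnion (A : Set (SphereAtInfinity n)) :
    cone A ⊆ ⋃ k : ℕ, ((k : ℝ) + 1) • (Ioo (0 : ℝ) 1 • ((↑) '' A) : Set (EuclideanSpace ℝ (Fin n))) := by
  rintro _ ⟨r, hr, u, hu, rfl⟩
  obtain ⟨k, hk⟩ := exists_nat_gt r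
  have hk0 : (0 : ℝ) < k + 1 := by positivity
  refine mem_iUnion.mpr ⟨k, mem_smul_set.mpr ⟨(r / (k + 1)) • (u : EuclideanSpace ℝ (Fin n)), ?_, ?_⟩⟩
  · refine smul_mem_smul ⟨by positivity, ?_⟩ (mem_image_of_mem _ hu)
    rw [div_lt_one hk0]
    linarith
  · rw [smul_smul]
    congr 1
    field_simp

theorem sphereMeasure_apply {A : Set (SphereAtInfinity n)} (hA : MeasurableSet A) :
    sphereMeasure n A
      = n * volume (Ioo (0 : ℝ) 1 • ((↑) '' A) : Set (EuclideanSpace ℝ (Fin n))) := by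
  rw [sphereMeasure, Measure.toSphere_apply' _ hA, finrank_euclideanSpace_fin]

/-- `A` need not be measurable, so it is replaced by a measurable hull, whose cone is a countable
union of dilated truncated cones. For `n = 0` the factor `n` in `sphereMeasure_apply` would carry no
information. -/
theorem volume_cone_eq_zero (hn : n ≠ 0) {A : Set (SphereAtInfinity n)}
    (hA : sphereMeasure n A = 0) : volume (cone A) = 0 := by
  set B := toMeasurable (sphereMeasure n) A with hBdef
  have hB : sphereMeasure n B = 0 := by rw [measure_toMeasurable, hA]
  rw [sphereMeasure_apply (measurableSet_toMeasurable _ _), mul_eq_zero] at hB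
  have hB := hB.resolve_left (by exact_mod_cast hn)
  have hsub : cone A ⊆ cone B := fun x ⟨r, hr, u, hu, hx⟩ ↦
    ⟨r, hr, u, subset_toMeasurable _ _ hu, hx⟩
  refine measure_mono_null (hsub.trans (cone_subset_iUnion B)) (measure_iUnion_null fun k ↦ ?_)
  rw [Measure.addHaar_smul, hB, mul_zero]

theorem volume_cone_pos {A : Set (SphereAtInfinity n)} (hAm : MeasurableSet A)
    (hA : 0 < sphereMeasure n A) : 0 < volume (cone A) := by
  rw [sphereMeasure_apply hAm] at hA
  exact (ENNReal.mul_pos_iff.mp hA).2.trans_le (measure_mono (Ioo_smul_subset_cone A))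

/-! ### Null points, tangent directions and density points -/

theorem span_singleton_ne_top (hn : 2 ≤ n) (x : EuclideanSpace ℝ (Fin n)) :
    Submodule.span ℝ {x} ≠ ⊤ := by
  intro h
  have h1 := finrank_span_le_card (R := ℝ) {x}
  rw [h, finrank_top, finrank_euclideanSpace_fin] at h1
  simp at h1
  omega

theorem sphereMeasure_singleton (hn : 2 ≤ n) (ξ : SphereAtInfinity n) :
    sphereMeasure n {ξ} = 0 := by
  rw [sphereMeasure_apply (measurableSet_singleton ξ)]
  have h := span_singleton_ne_top hn (ξ : EuclideanSpace ℝ (Fin n))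
  rw [measure_mono_null ?_ (Measure.addHaar_submodule volume _ h), mul_zero]
  rintro _ ⟨r, -, _, ⟨_, rfl, rfl⟩, rfl⟩
  exact Submodule.smul_mem _ _ (Submodule.mem_span_singleton_self _)

theorem exists_unit_orthogonal (hn : 2 ≤ n) (ξ : SphereAtInfinity n) :
    ∃ e : EuclideanSpace ℝ (Fin n), ‖e‖ = 1 ∧ inner ℝ e (ξ : EuclideanSpace ℝ (Fin n)) = 0 := by
  have h := span_singleton_ne_top hn (ξ : EuclideanSpace ℝ (Fin n))
  have h2 : (Submodule.span ℝ {(ξ : EuclideanSpace ℝ (Fin n))})ᗮ ≠ ⊥ := by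
    rwa [Ne, Submodule.orthogonal_eq_bot_iff]
  obtain ⟨v, hv, hv0⟩ := Submodule.exists_mem_ne_zero_of_ne_bot h2
  refine ⟨‖v‖⁻¹ • v, norm_smul_inv_norm hv0, ?_⟩
  rw [inner_smul_left, real_inner_comm, Submodule.mem_orthogonal_singleton_iff_inner_right.mp hv,
    mul_zero]

/-- Almost every point of a subset of the sphere is a density point of the cone over it. -/
theorem exists_density_point {A : Set (SphereAtInfinity n)} (hAm : MeasurableSet A)
    (hA : 0 < sphereMeasure n A) :
    ∃ ξ ∈ A, Tendsto (fun r ↦ volume ((cone A)ᶜ ∩ Metric.closedBall (ξ : EuclideanSpace ℝ (Fin n)) r)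
      / volume (Metric.closedBall (ξ : EuclideanSpace ℝ (Fin n)) r)) (𝓝[>] 0) (𝓝 0) := by
  have h1 := Besicovitch.ae_tendsto_measure_inter_div_of_measurableSet volume
    (measurableSet_cone hAm).compl
  obtain ⟨x, hx, hxA⟩ : ∃ x, Tendsto (fun r ↦ volume ((cone A)ᶜ ∩ Metric.closedBall x r)
      / volume (Metric.closedBall x r)) (𝓝[>] 0) (𝓝 ((cone A)ᶜ.indicator 1 x)) ∧ x ∈ cone A := by
    by_contra! hcon
    exact (volume_cone_pos hAm hA).ne' (measure_mono_null (fun x hx h ↦ hcon x h hx) h1)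
  rw [indicator_of_notMem (notMem_compl_iff.mpr hxA)] at hx
  obtain ⟨ρ, hρ, ξ, hξ, rfl⟩ := hxA
  refine ⟨ξ, hξ, ?_⟩
  -- The cone is invariant under dilation, so density at `ρ ξ` rescales to density at `ξ`.
  have h2 : Tendsto (fun r : ℝ ↦ ρ * r) (𝓝[>] 0) (𝓝[>] 0) := by
    refine tendsto_nhdsWithin_iff.mpr ⟨?_, ?_⟩
    · have : Tendsto (fun r : ℝ ↦ ρ * r) (𝓝 0) (𝓝 (ρ * 0)) := tendsto_id.const_mul ρ
      rw [mul_zero] at this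
      exact this.mono_left nhdsWithin_le_nhds
    · filter_upwards [self_mem_nhdsWithin] with r hr
      exact mul_pos hρ hr
  refine (hx.comp h2).congr fun r ↦ ?_
  have e1 : Metric.closedBall (ρ • (ξ : EuclideanSpace ℝ (Fin n))) (ρ * r)
      = ρ • Metric.closedBall (ξ : EuclideanSpace ℝ (Fin n)) r := by
    rw [smul_closedBall' hρ.ne', Real.norm_of_nonneg hρ.le]
  have e2 : (cone A)ᶜ ∩ Metric.closedBall (ρ • (ξ : EuclideanSpace ℝ (Fin n))) (ρ * r)
      = ρ • ((cone A)ᶜ ∩ Metric.closedBall (ξ : EuclideanSpace ℝ (Fin n)) r) := by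
    have e (B : Set (EuclideanSpace ℝ (Fin n))) : (cone A)ᶜ ∩ B = B \ cone A := inter_comm _ _
    rw [e, e, smul_set_sdiff₀ hρ.ne', smul_cone hρ, e1]
  simp only [Function.comp]
  rw [e2, e1, Measure.addHaar_smul, Measure.addHaar_smul, ENNReal.mul_div_mul_left _ _ ?_ ENNReal.ofReal_ne_top]
  rw [Ne, ENNReal.ofReal_eq_zero, not_le]
  positivity

/-! ### The radial extension of a boundary map -/

/-- The homogeneous extension to `ℝⁿ` of the boundary map of an isometry. -/
def radialMap (g : Iso n) (x : EuclideanSpace ℝ (Fin n)) : EuclideanSpace ℝ (Fin n) :=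
  if h : x ≠ 0 then (exists_polar h).choose •
    (boundaryMap g (exists_polar h).choose_spec.2.choose : EuclideanSpace ℝ (Fin n)) else 0

theorem radialMap_smul (g : Iso n) {r : ℝ} (hr : 0 < r) (u : SphereAtInfinity n) :
    radialMap g (r • (u : EuclideanSpace ℝ (Fin n)))
      = r • (boundaryMap g u : EuclideanSpace ℝ (Fin n)) := by
  have h := ne_zero_of_polar hr u
  obtain ⟨h1, h2⟩ := polar_unique hr (exists_polar h).choose_spec.1
    (exists_polar h).choose_spec.2.choose_spec
  rw [radialMap, dif_pos h]
  exact congrArg₂ (fun (a : ℝ) (w : SphereAtInfinity n) ↦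
    a • (boundaryMap g w : EuclideanSpace ℝ (Fin n))) h1.symm h2.symm

theorem abs_sub_one_le {r : ℝ} (hr : 0 < r) (u ξ : SphereAtInfinity n) :
    |r - 1| ≤ ‖r • (u : EuclideanSpace ℝ (Fin n)) - ξ‖ := by
  have := abs_norm_sub_norm_le (r • (u : EuclideanSpace ℝ (Fin n))) ξ
  rwa [norm_smul, norm_eq_of_mem_sphere, norm_eq_of_mem_sphere, Real.norm_of_nonneg hr.le,
    mul_one] at this

theorem norm_smul_sub_self (r : ℝ) (u : SphereAtInfinity n) :
    ‖r • (u : EuclideanSpace ℝ (Fin n)) - u‖ = |r - 1| := by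
  have : r • (u : EuclideanSpace ℝ (Fin n)) - u = (r - 1) • (u : EuclideanSpace ℝ (Fin n)) := by
    module
  rw [this, norm_smul, norm_eq_of_mem_sphere, mul_one, Real.norm_eq_abs]

theorem norm_sub_le_of_polar {r : ℝ} (hr : 0 < r) (u ξ : SphereAtInfinity n) :
    ‖(u : EuclideanSpace ℝ (Fin n)) - ξ‖ ≤ 2 * ‖r • (u : EuclideanSpace ℝ (Fin n)) - ξ‖ := by
  have h1 := norm_sub_le_norm_sub_add_norm_sub (u : EuclideanSpace ℝ (Fin n))
    (r • (u : EuclideanSpace ℝ (Fin n))) ξ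
  rw [norm_sub_rev, norm_sub_rev (u : EuclideanSpace ℝ (Fin n)) (r • _), norm_smul_sub_self,
    norm_sub_rev] at h1
  linarith [abs_sub_one_le hr u ξ]

/-- In polar coordinates a difference is controlled by `|r - s|` and `s ‖u - v‖`, and it controls
both in turn. An estimate on the sphere therefore passes to the radial extension. -/
theorem norm_polar_sub_le {c : ℝ} (hc : 0 ≤ c) {r s : ℝ} (hr : 0 < r) (hs : 0 < s)
    {u v u' v' : SphereAtInfinity n}
    (h : ‖(u : EuclideanSpace ℝ (Fin n)) - v‖ ≤ c * ‖(u' : EuclideanSpace ℝ (Fin n)) - v'‖) :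
    ‖r • (u : EuclideanSpace ℝ (Fin n)) - s • (v : EuclideanSpace ℝ (Fin n))‖
      ≤ (1 + 2 * c) * ‖r • (u' : EuclideanSpace ℝ (Fin n)) - s • (v' : EuclideanSpace ℝ (Fin n))‖ := by
  set F := ‖r • (u' : EuclideanSpace ℝ (Fin n)) - s • (v' : EuclideanSpace ℝ (Fin n))‖
  have h1 : |r - s| ≤ F := by
    have := abs_norm_sub_norm_le (r • (u' : EuclideanSpace ℝ (Fin n)))
      (s • (v' : EuclideanSpace ℝ (Fin n)))
    rwa [norm_smul, norm_smul, norm_eq_of_mem_sphere, norm_eq_of_mem_sphere,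
      Real.norm_of_nonneg hr.le, Real.norm_of_nonneg hs.le, mul_one, mul_one] at this
  have h2 : s * ‖(u' : EuclideanSpace ℝ (Fin n)) - v'‖ ≤ 2 * F := by
    have e : s • ((u' : EuclideanSpace ℝ (Fin n)) - v') = (r • (u' : EuclideanSpace ℝ (Fin n))
        - s • (v' : EuclideanSpace ℝ (Fin n))) - (r - s) • (u' : EuclideanSpace ℝ (Fin n)) := by
      module
    have := norm_sub_le (r • (u' : EuclideanSpace ℝ (Fin n))
        - s • (v' : EuclideanSpace ℝ (Fin n))) ((r - s) • (u' : EuclideanSpace ℝ (Fin n)))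
    rw [← e, norm_smul, norm_smul, norm_eq_of_mem_sphere, Real.norm_of_nonneg hs.le,
      Real.norm_eq_abs, mul_one] at this
    linarith
  have h3 : ‖r • (u : EuclideanSpace ℝ (Fin n)) - s • (v : EuclideanSpace ℝ (Fin n))‖
      ≤ |r - s| + s * ‖(u : EuclideanSpace ℝ (Fin n)) - v‖ := by
    have e : r • (u : EuclideanSpace ℝ (Fin n)) - s • (v : EuclideanSpace ℝ (Fin n))
        = (r - s) • (u : EuclideanSpace ℝ (Fin n)) + s • ((u : EuclideanSpace ℝ (Fin n)) - v) := by
      module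
    have := norm_add_le ((r - s) • (u : EuclideanSpace ℝ (Fin n)))
      (s • ((u : EuclideanSpace ℝ (Fin n)) - v))
    rwa [← e, norm_smul, norm_smul, norm_eq_of_mem_sphere, Real.norm_of_nonneg hs.le,
      Real.norm_eq_abs, mul_one] at this
  have h4 : s * ‖(u : EuclideanSpace ℝ (Fin n)) - v‖ ≤ c * (2 * F) := by
    calc _ ≤ s * (c * ‖(u' : EuclideanSpace ℝ (Fin n)) - v'‖) := by gcongr
      _ = c * (s * ‖(u' : EuclideanSpace ℝ (Fin n)) - v'‖) := by ring
      _ ≤ _ := by gcongr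
  linarith

/-- Near `ξ` there is a ball, of size comparable to the shadow of `z`, on which the radial map is
expanding up to a bounded factor and whose image stays near `ξ`. -/
theorem exists_good_ball (hn : 2 ≤ n) (g : Iso n) {z : HyperbolicSpace n} {p : ℝ}
    (hp : coshDist z (g z) ≤ p) {ξ : SphereAtInfinity n}
    (hz : ‖z.coords - ξ‖ ≤ 1 - ‖z.coords‖ ^ 2) (hδ4 : 1 - ‖z.coords‖ ^ 2 ≤ 1 / 4) :
    ∃ c : EuclideanSpace ℝ (Fin n), ‖c - ξ‖ ≤ 1 - ‖z.coords‖ ^ 2 ∧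
      (∀ x ∈ Metric.closedBall c ((1 - ‖z.coords‖ ^ 2) / 10),
        ‖radialMap g x - ξ‖ ≤ (4800 * p + 2) * (1 - ‖z.coords‖ ^ 2)) ∧
      ∀ x ∈ Metric.closedBall c ((1 - ‖z.coords‖ ^ 2) / 10),
        ∀ y ∈ Metric.closedBall c ((1 - ‖z.coords‖ ^ 2) / 10),
          dist x y ≤ (1 + 2 * (600 * p)) * dist (radialMap g x) (radialMap g y) := by
  have hp1 := (one_le_coshDist z (g z)).trans hp
  obtain ⟨e, he, heξ⟩ := exists_unit_orthogonal hn ξ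
  have hδ := one_sub_normSq_pos z
  have hexp (u v : SphereAtInfinity n) := norm_sub_le_boundaryMap g hp (u := u) (v := v) hz
  have hnear (u v : SphereAtInfinity n) := boundaryMap_near_or_near g hp (u := u) (v := v) hz
  set δ := 1 - ‖z.coords‖ ^ 2
  have hdist {c x : EuclideanSpace ℝ (Fin n)} (hc : ‖c - ξ‖ ≤ δ)
      (hx : x ∈ Metric.closedBall c (δ / 10)) : ‖x - ξ‖ ≤ 11 / 10 * δ := by
    rw [mem_closedBall_iff_norm] at hx
    linarith [norm_sub_le_norm_sub_add_norm_sub x c (ξ : EuclideanSpace ℝ (Fin n))]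
  have hpolar {x : EuclideanSpace ℝ (Fin n)} (hx : ‖x - ξ‖ ≤ 11 / 10 * δ) :
      ∃ r : ℝ, 0 < r ∧ r ≤ 2 ∧ ∃ u : SphereAtInfinity n, x = r • (u : EuclideanSpace ℝ (Fin n)) ∧
        |r - 1| ≤ 2 * δ ∧ ‖(u : EuclideanSpace ℝ (Fin n)) - ξ‖ ≤ 4 * δ := by
    have hx0 : x ≠ 0 := by
      rintro rfl
      rw [zero_sub, norm_neg, norm_eq_of_mem_sphere] at hx
      linarith
    obtain ⟨r, hr, u, rfl⟩ := exists_polar hx0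
    have h1 := abs_sub_one_le hr u ξ
    have h2 := norm_sub_le_of_polar hr u ξ
    refine ⟨r, hr, ?_, u, rfl, by linarith, by linarith⟩
    linarith [le_abs_self (r - 1)]
  have hmain (c : EuclideanSpace ℝ (Fin n)) (hc : ‖c - ξ‖ ≤ δ)
      (hcn : ∀ r : ℝ, 0 < r → ∀ u : SphereAtInfinity n,
        r • (u : EuclideanSpace ℝ (Fin n)) ∈ Metric.closedBall c (δ / 10) →
        ‖(boundaryMap g u : EuclideanSpace ℝ (Fin n)) - ξ‖ ≤ 4800 * p * δ) :
      (∀ x ∈ Metric.closedBall c (δ / 10), ‖radialMap g x - ξ‖ ≤ (4800 * p + 2) * δ) ∧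
      ∀ x ∈ Metric.closedBall c (δ / 10), ∀ y ∈ Metric.closedBall c (δ / 10),
          dist x y ≤ (1 + 2 * (600 * p)) * dist (radialMap g x) (radialMap g y) := by
    refine ⟨fun x hx ↦ ?_, fun x hx y hy ↦ ?_⟩
    · obtain ⟨r, hr, -, u, rfl, hr1, hu⟩ := hpolar (hdist hc hx)
      rw [radialMap_smul g hr]
      have h1 := norm_sub_le_norm_sub_add_norm_sub
        (r • (boundaryMap g u : EuclideanSpace ℝ (Fin n))) (boundaryMap g u) ξ
      rw [norm_smul_sub_self] at h1
      linarith [hcn r hr u hx]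
    · obtain ⟨r, hr, -, u, rfl, -, hu⟩ := hpolar (hdist hc hx)
      obtain ⟨s, hs, -, v, rfl, -, hv⟩ := hpolar (hdist hc hy)
      rw [radialMap_smul g hr, radialMap_smul g hs, dist_eq_norm, dist_eq_norm]
      exact norm_polar_sub_le (by positivity) hr hs (hexp u v hu hv)
  have hc1 : ‖(ξ : EuclideanSpace ℝ (Fin n)) - ξ‖ ≤ δ := by simpa using hδ.le
  have hc2 : ‖((ξ : EuclideanSpace ℝ (Fin n)) + δ • e) - ξ‖ ≤ δ := by
    rw [add_sub_cancel_left, norm_smul, he, mul_one, Real.norm_of_nonneg hδ.le]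
  -- The ball about `ξ` serves unless it contains the direction of some `u` that is sent far away.
  -- In that case every direction `v` met by the ball about the tangentially shifted center `ξ + δ
  -- e` is at least `δ / 4` from `u`, and `boundaryMap_near_or_near` keeps its image near `ξ`.
  by_cases hcase : ∀ r : ℝ, 0 < r → ∀ u : SphereAtInfinity n,
      r • (u : EuclideanSpace ℝ (Fin n)) ∈ Metric.closedBall (ξ : EuclideanSpace ℝ (Fin n)) (δ / 10) →
        ‖(boundaryMap g u : EuclideanSpace ℝ (Fin n)) - ξ‖ ≤ 4800 * p * δ
  · exact ⟨ξ, hc1, hmain _ hc1 hcase⟩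
  · push Not at hcase
    obtain ⟨r, hr, u, hu, hfar⟩ := hcase
    refine ⟨(ξ : EuclideanSpace ℝ (Fin n)) + δ • e, hc2, hmain _ hc2 fun s hs v hv ↦ ?_⟩
    have hu' : ‖(u : EuclideanSpace ℝ (Fin n)) - ξ‖ ≤ δ / 5 := by
      rw [mem_closedBall_iff_norm] at hu
      linarith [norm_sub_le_of_polar hr u ξ]
    obtain ⟨s', hs', hs2, v', hvv, -, hvξ⟩ := hpolar (hdist hc2 hv)
    obtain ⟨rfl, rfl⟩ := polar_unique hs hs' hvv
    have h1 : 9 / 10 * δ ≤ s * inner ℝ e (v : EuclideanSpace ℝ (Fin n)) := by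
      rw [mem_closedBall_iff_norm] at hv
      have h2 := abs_le.mp ((abs_real_inner_le_norm e _).trans
        (mul_le_mul_of_nonneg_left hv (norm_nonneg e)))
      rw [inner_sub_right, inner_add_right, inner_smul_right, inner_smul_right, heξ,
        real_inner_self_eq_norm_sq, he] at h2
      linarith [h2.1]
    -- Division by the radius `s ≤ 2`. Subtracting `‖u - ξ‖ ≤ δ / 5` from `9 / 20 * δ` leaves the
    -- separation `δ / 4`.
    have h3 : 9 / 20 * δ ≤ inner ℝ e (v : EuclideanSpace ℝ (Fin n)) := by
      have h4 : 0 < inner ℝ e (v : EuclideanSpace ℝ (Fin n)) := by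
        by_contra! h5
        nlinarith
      nlinarith
    have h5 : 9 / 20 * δ ≤ ‖(v : EuclideanSpace ℝ (Fin n)) - ξ‖ := by
      have h6 := real_inner_le_norm e ((v : EuclideanSpace ℝ (Fin n)) - ξ)
      rw [inner_sub_right, heξ, sub_zero, he, one_mul] at h6
      linarith
    have h7 : δ / 4 ≤ ‖(u : EuclideanSpace ℝ (Fin n)) - v‖ := by
      have h8 := norm_sub_le_norm_sub_add_norm_sub (v : EuclideanSpace ℝ (Fin n)) u ξ
      rw [norm_sub_rev (v : EuclideanSpace ℝ (Fin n)) u] at h8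
      linarith
    exact (hnear u v (by linarith) hvξ h7).resolve_left hfar.not_ge

/-! ### Conservativity -/

/-- Near a density point of `A`, an isometry that moves a point close to the density point by a
bounded distance cannot move `A` off itself. -/
theorem exists_scale_measure_inter_ne_zero (hn : 2 ≤ n) {A : Set (SphereAtInfinity n)}
    {ξ : SphereAtInfinity n}
    (hξ : Tendsto (fun r ↦ volume ((cone A)ᶜ ∩ Metric.closedBall (ξ : EuclideanSpace ℝ (Fin n)) r)
      / volume (Metric.closedBall (ξ : EuclideanSpace ℝ (Fin n)) r)) (𝓝[>] 0) (𝓝 0))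
    {p : ℝ} (hp1 : 1 ≤ p) :
    ∃ ε > 0, ∀ z : HyperbolicSpace n, 1 - ‖z.coords‖ ^ 2 < ε →
      ‖z.coords - ξ‖ ≤ 1 - ‖z.coords‖ ^ 2 → ∀ g : Iso n, coshDist z (g z) ≤ p →
        sphereMeasure n (boundaryMap g '' A ∩ A) ≠ 0 := by
  set M : ℝ := 4800 * p + 2 with hM
  have hM0 : 0 < M := by positivity
  set L : ℝ≥0 := ⟨1 + 2 * (600 * p), by positivity⟩ with hL
  -- `(10 M) ^ n` is the volume ratio of the large ball `B` to the small ball `U`. In `U`, the part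
  -- off the cone has volume at most `κ * volume B` and the part in it at most `L ^ n` times that;
  -- `κ * Q < 1` makes the two too small to fill `U`.
  set Q : ℝ≥0∞ := (1 + (L : ℝ≥0∞) ^ n) * ENNReal.ofReal ((10 * M) ^ n) with hQ
  have hQtop : Q ≠ ∞ := ENNReal.mul_ne_top
    (ENNReal.add_ne_top.mpr ⟨ENNReal.one_ne_top, ENNReal.pow_ne_top ENNReal.coe_ne_top⟩)
    ENNReal.ofReal_ne_top
  obtain ⟨κ, hκ0, hκ⟩ := ENNReal.exists_nnreal_pos_mul_lt hQtop one_ne_zero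
  have hev := hξ.eventually_lt_const (ENNReal.coe_pos.mpr hκ0)
  obtain ⟨r₀, hr₀, hr⟩ := mem_nhdsGT_iff_exists_Ioo_subset.mp hev
  have hr₀ : 0 < r₀ := hr₀
  refine ⟨min (1 / 4) (r₀ / M), by positivity, fun z hz hzξ g hg hnull ↦ ?_⟩
  obtain ⟨c, hc, hnear, hexp⟩ := exists_good_ball hn g hg hzξ (hz.le.trans (min_le_left _ _))
  have hδ := one_sub_normSq_pos z
  have hδr : M * (1 - ‖z.coords‖ ^ 2) < r₀ := by
    have := hz.trans_le (min_le_right _ _)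
    rwa [lt_div_iff₀ hM0, mul_comm] at this
  set δ := 1 - ‖z.coords‖ ^ 2
  set U := Metric.closedBall c (δ / 10)
  set B := Metric.closedBall (ξ : EuclideanSpace ℝ (Fin n)) (M * δ)
  have hsmall : volume ((cone A)ᶜ ∩ B) ≤ κ * volume B := by
    have h1 : volume ((cone A)ᶜ ∩ B) / volume B < κ := hr ⟨by positivity, hδr⟩
    exact (ENNReal.div_le_iff_le_mul (Or.inr ENNReal.coe_ne_top)
      (Or.inl measure_closedBall_lt_top.ne)).mp h1.le
  have hUB : U ⊆ B := by
    refine Metric.closedBall_subset_closedBall' ?_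
    rw [dist_eq_norm]
    nlinarith
  have hT : volume (U ∩ cone A) ≤ (L : ℝ≥0∞) ^ n * volume (radialMap g '' (U ∩ cone A)) :=
    volume_le_of_dist_le_mul fun x hx y hy ↦ hexp x hx.1 y hy.1
  -- Image points stay in `B`; those not in the cone over `A` are few by density, and the others lie
  -- over `boundaryMap g '' A ∩ A`, which is null by assumption.
  have himg : radialMap g '' (U ∩ cone A) ⊆ ((cone A)ᶜ ∩ B) ∪ cone (boundaryMap g '' A ∩ A) := by
    rintro _ ⟨x, ⟨hxU, r, hr, u, hu, rfl⟩, rfl⟩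
    have h1 := hnear _ hxU
    rw [radialMap_smul g hr] at h1 ⊢
    by_cases h2 : boundaryMap g u ∈ A
    · exact Or.inr ⟨r, hr, _, ⟨mem_image_of_mem _ hu, h2⟩, rfl⟩
    · exact Or.inl ⟨fun h ↦ h2 ((smul_mem_cone hr).mp h), mem_closedBall_iff_norm.mpr h1⟩
  have himg' : volume (radialMap g '' (U ∩ cone A)) ≤ κ * volume B := by
    refine (measure_mono himg).trans ((measure_union_le _ _).trans ?_)
    rw [volume_cone_eq_zero (by omega) hnull, add_zero]
    exact hsmall
  have hvol : volume B = ENNReal.ofReal ((10 * M) ^ n) * volume U := by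
    rw [Measure.addHaar_closedBall _ _ (by positivity), Measure.addHaar_closedBall _ _ (by positivity),
      ← mul_assoc, ← ENNReal.ofReal_mul (by positivity), finrank_euclideanSpace_fin, ← mul_pow]
    congr 3
    ring
  have hU0 : volume U ≠ 0 := (Metric.measure_closedBall_pos _ _ (by positivity)).ne'
  have hUtop : volume U ≠ ∞ := measure_closedBall_lt_top.ne
  have hfin : volume U ≤ κ * Q * volume U := by
    calc volume U ≤ volume ((cone A)ᶜ ∩ B) + volume (U ∩ cone A) := by
          refine (measure_mono fun x hx ↦ ?_).trans (measure_union_le _ _)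
          by_cases h : x ∈ cone A
          · exact Or.inr ⟨hx, h⟩
          · exact Or.inl ⟨h, hUB hx⟩
      _ ≤ κ * volume B + (L : ℝ≥0∞) ^ n * (κ * volume B) := by
          gcongr
          exact hT.trans (by gcongr)
      _ = κ * Q * volume U := by
          rw [hvol, hQ]
          ring
  have hlt : κ * Q * volume U < 1 * volume U := ENNReal.mul_lt_mul_left hU0 hUtop hκ
  rw [one_mul] at hlt
  exact hlt.not_ge hfin

theorem actsConservativelyOn_of_two_le (hn : 2 ≤ n) {Γ : Subgroup (Iso n)} {R : ℝ≥0}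
    (hinj : ∀ p ∈ convexCore Γ, injRadius Γ p ≤ R) (x₀ : HyperbolicSpace n) :
    ActsConservativelyOn Γ (limitSet Γ x₀) := by
  rintro ⟨A, hAL, hAm, hApos, hdisj⟩
  obtain ⟨ξ, hξA, hξ⟩ := exists_density_point hAm hApos
  -- A geodesic ending at `ξ` needs a second limit point; `A` has one because single points are
  -- null.
  obtain ⟨η, hηA, hne⟩ : ∃ η ∈ A, ξ ≠ η := by
    by_contra! h
    have : A ⊆ {ξ} := fun η hη ↦ (h η hη).symm
    exact hApos.ne' (measure_mono_null this (sphereMeasure_singleton hn ξ))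
  obtain ⟨ε, hε, hscale⟩ := exists_scale_measure_inter_ne_zero hn hξ
    (Real.one_le_cosh (2 * ((R : ℝ) + 1)))
  obtain ⟨z, hz, hzε, hzξ⟩ := exists_mem_convexHullOf (hAL hξA) (hAL hηA) hne hε
  obtain ⟨γ, hγ, hγ1, hd⟩ := exists_short_translate (hinj _ ⟨z, hz, rfl⟩)
  refine hscale z hzε hzξ γ ?_ ?_
  · rw [← cosh_dist, Real.cosh_le_cosh, abs_of_nonneg dist_nonneg, abs_of_nonneg (by positivity)]
    exact hd.le
  · have h1 := hdisj γ hγ 1 Γ.one_mem hγ1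
    rw [translate_eq_image, translate_eq_image] at h1
    have h2 : boundaryMap (1 : Iso n) '' A = A := by
      rw [funext boundaryMap_one, image_id']
    rwa [h2] at h1

/-! ### Low dimensions: finite sphere at infinity -/

theorem infinite_of_mem_limitSet {Γ : Subgroup (Iso n)} {x₀ : HyperbolicSpace n}
    {ξ : SphereAtInfinity n} (hξ : ξ ∈ limitSet Γ x₀) : Infinite Γ := by
  by_contra hfin
  rw [not_infinite_iff_finite] at hfin
  have h1 : (coords '' MulAction.orbit Γ x₀).Finite := (finite_range _).image _
  have h2 : (ξ : EuclideanSpace ℝ (Fin n)) ∈ closure (coords '' MulAction.orbit Γ x₀) := hξ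
  rw [h1.isClosed.closure_eq] at h2
  obtain ⟨x, -, hx⟩ := h2
  have := x.norm_lt_one
  rw [hx, norm_eq_of_mem_sphere] at this
  exact lt_irrefl _ this

/-- If the sphere at infinity is finite (`n ≤ 1`), a group with a limit point acts
conservatively. -/
theorem actsConservativelyOn_of_finite [Finite (SphereAtInfinity n)] (Γ : Subgroup (Iso n))
    (x₀ : HyperbolicSpace n) : ActsConservativelyOn Γ (limitSet Γ x₀) := by
  rintro ⟨A, hAL, -, hApos, hdisj⟩
  obtain ⟨ξ, hξA⟩ : A.Nonempty := by
    rw [nonempty_iff_ne_empty]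
    rintro rfl
    simp at hApos
  have := infinite_of_mem_limitSet (hAL hξA)
  -- An infinite group acting on a finite sphere has two elements that agree at `ξ`. Their
  -- translates of `A` share that image point, which is open and so has positive measure.
  obtain ⟨γ₁, γ₂, hne, heq⟩ :=
    Finite.exists_ne_map_eq_of_infinite fun γ : Γ ↦ boundaryMap (γ : Iso n) ξ
  have h1 := hdisj γ₁ γ₁.2 γ₂ γ₂.2 (fun h ↦ hne (Subtype.ext h))
  rw [translate_eq_image, translate_eq_image] at h1
  have h2 : 0 < sphereMeasure n {boundaryMap (γ₁ : Iso n) ξ} := by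
    unfold sphereMeasure
    exact (isOpen_discrete _).measure_pos _ (singleton_nonempty _)
  refine h2.ne' (measure_mono_null ?_ h1)
  rintro _ rfl
  exact ⟨mem_image_of_mem _ hξA, ⟨ξ, hξA, heq.symm⟩⟩

theorem finite_sphereAtInfinity (hn : n < 2) : Finite (SphereAtInfinity n) := by
  interval_cases n
  · infer_instance
  · have : Set.Finite {x : EuclideanSpace ℝ (Fin 1) | x 0 = 1 ∨ x 0 = -1} := by
      refine Finite.of_injOn (f := fun x ↦ x 0) (t := {1, -1}) (fun x hx ↦ hx) ?_ (by simp)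
      intro x _ y _ h
      ext i
      rw [Subsingleton.elim i 0]
      exact h
    refine this.subset fun x hx ↦ ?_
    rw [mem_sphere_zero_iff_norm, EuclideanSpace.norm_eq] at hx
    simp only [Fin.sum_univ_one, Real.norm_eq_abs, Real.sqrt_sq (abs_nonneg _)] at hx
    exact eq_or_eq_neg_of_abs_eq hx

end HyperbolicSpace

end

theorem mainTheorem11 (n : ℕ) (Γ : Subgroup (HyperbolicSpace.Iso n))
    (hΓ : HyperbolicSpace.IsDiscreteGroup Γ)
    (hinj : ∃ R : ℝ≥0, ∀ p ∈ HyperbolicSpace.convexCore Γ,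
      HyperbolicSpace.injRadius Γ p ≤ (R : ℝ≥0∞))
    (x₀ : HyperbolicSpace n) :
    HyperbolicSpace.ActsConservativelyOn Γ (HyperbolicSpace.limitSet Γ x₀) := by
  obtain ⟨R, hR⟩ := hinj
  -- The density argument needs null points and a direction tangent to the sphere at `ξ`, hence `2 ≤
  -- n`.
  rcases lt_or_ge n 2 with hn | hn
  · have := HyperbolicSpace.finite_sphereAtInfinity hn
    exact HyperbolicSpace.actsConservativelyOn_of_finite Γ x₀
  · exact HyperbolicSpace.actsConservativelyOn_of_two_le hn hR x₀
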